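/- **Setting.** Let $(P_t)_{t\ge 0}$ be a Markov semigroup on a measurable space $E$, given by Markov kernels $P_t(x,dy)$ with $P_0=\mathrm{Id}$, $P_{s+t}=P_sP_t$, and $P_tf(x)=\int f(y)\,P_t(x,dy)$. Let $L f=\partial_t P_t f|_{t=0}$ be its generator; $f$ is in its domain if $(P_tf-f)/t$ converges pointwise and boundedly as $t\to0^+$. Suppose that $(P_t)$ is a *diffusion semigroup*: there is a unital algebra $\mathcal A$ of bounded measurable real functions on $E$, contained in the domain of $L$ and stable under each $P_t$, under $L$ and under composition with functions $\phi\in C^\infty(\mathbb R)$, such that for all $f\in\mathcal A$ and $\phi\in C^\infty(\mathbb R)$ $$L\phi(f)=\phi'(f)\,Lf+\phi''(f)\,\Gamma(f),\qquad\text{where } \Gamma(f,g)=\tfrac12\big(L(fg)-f\,Lg-g\,Lf\big),\quad \Gamma(f)=\Gamma(f,f).$$ Put $\Gamma_2(f)=\tfrac12\big(L\Gamma(f)-2\Gamma(f,Lf)\big)$. For $\rho\in\mathbb R$, the semigroup satisfies $CD(\rho,\infty)$ if $\Gamma_2(f)\ge\rho\,\Gamma(f)$ on $E$ for all $f\in\mathcal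 A$. For $f\in\mathcal A$ and $t>0$ let $Q_tf$ be the vanishing viscosity solution at time $t$ of the Hamilton–Jacobi equation $\partial_t v+\frac12\Gamma(v)=0$, $v_0=f$, i.e. $$Q_tf=\liminf_{\varepsilon\to0^+}v^\varepsilon_t,\qquad v^\varepsilon_t=-2\varepsilon\log P_{\varepsilon t}\big(e^{-f/(2\varepsilon)}\big),$$ where $v^\varepsilon$ solves $\partial_t v^\varepsilon+\frac12\Gamma(v^\varepsilon)-\varepsilon L v^\varepsilon=0$, $v^\varepsilon_0=f$ (the lower limit is the limit whenever the limit exists). **Theorem.** Let $\rho\in\mathbb R$ and let $(P_t)_{t\ge0}$ be a diffusion Markov semigroup. The following are equivalent: (i) $(P_t)_{t\ge0}$ satisfies the $CD(\rho,\infty)$ criterion; (ii) for all $q_1>q_2>0$ and $u,t>0$ such that $$q_1=q_2+\frac{\rho t}{1-e^{-2\rho u}}$$ (to be read as $q_1=q_2+\frac{t}{2u}$ when $\rho=0$), one has, everywhere on $E$ and for all $f\in\mathcal A$, $$P_u\big(e^{q_1Q_tf}\big)^{1/q_1}\le P_u\big(e^{q_2f}\big)^{1/q_2}.$$ -/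

import Mathlib

open MeasureTheory ProbabilityTheory Filter Topology Set
open scoped ContDiff

noncomputable section

/-- A Markov semigroup on a measurable space `E`: a family of Markov kernels indexed by the times
`t ≥ 0` (negative times carry no information), starting from the identity and satisfying the
Chapman-Kolmogorov (semigroup) property. -/
structure MarkovSemigroup (E : Type*) [MeasurableSpace E] where
  /-- the transition kernels `P_t(x, dy)` -/
  kernel : ℝ → Kernel E E
  isMarkov : ∀ t, 0 ≤ t → IsMarkovKernel (kernel t)
  kernel_zero : kernel 0 = Kernel.id
  kernel_add : ∀ s t, 0 ≤ s → 0 ≤ t → kernel (s + t) = kernel t ∘ₖ kernel s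

namespace MarkovSemigroup

variable {E : Type*} [MeasurableSpace E] (P : MarkovSemigroup E)

/-- The operator `P_t`: `P_t f (x) = ∫ f(y) P_t(x, dy)`. -/
def op (t : ℝ) (f : E → ℝ) (x : E) : ℝ := ∫ y, f y ∂(P.kernel t x)

/-- The infinitesimal generator `L f = ∂_t P_t f` at `t = 0` (right derivative). -/
def gen (f : E → ℝ) (x : E) : ℝ := derivWithin (fun t => P.op t f x) (Ici 0) 0

/-- `f` belongs to the domain of the generator: `(P_t f - f) / t` converges pointwise and
boundedly as `t → 0+`. -/
def InDomain (f : E → ℝ) : Prop :=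
  (∀ x, DifferentiableWithinAt ℝ (fun t => P.op t f x) (Ici 0) 0) ∧
    ∃ C : ℝ, ∀ t, 0 ≤ t → ∀ x, |P.op t f x - f x| ≤ C * t

/-- The carré du champ `Γ(f, g) = (L(fg) - f Lg - g Lf) / 2`. -/
def carreDuChamp (f g : E → ℝ) (x : E) : ℝ :=
  (P.gen (fun y => f y * g y) x - f x * P.gen g x - g x * P.gen f x) / 2

/-- The iterated carré du champ `Γ₂(f) = (L Γ(f) - 2 Γ(f, Lf)) / 2`. -/
def gammaTwo (f : E → ℝ) (x : E) : ℝ :=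
  (P.gen (P.carreDuChamp f f) x - 2 * P.carreDuChamp f (P.gen f) x) / 2

/-- `P` is a diffusion semigroup with (nice) algebra `A`: a unital algebra of bounded measurable
functions in the domain of the generator `L`, stable under the semigroup, under `L` and under
composition with smooth functions, and on which `L` satisfies the diffusion property
`L φ(f) = φ'(f) L f + φ''(f) Γ(f)`. -/
structure IsDiffusion (A : Subalgebra ℝ (E → ℝ)) : Prop where
  measurable : ∀ f ∈ A, Measurable f
  bounded : ∀ f ∈ A, ∃ C : ℝ, ∀ x, |f x| ≤ C
  inDomain : ∀ f ∈ A, P.InDomain f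
  op_mem : ∀ t, 0 ≤ t → ∀ f ∈ A, P.op t f ∈ A
  gen_mem : ∀ f ∈ A, P.gen f ∈ A
  comp_mem : ∀ φ : ℝ → ℝ, ContDiff ℝ ∞ φ → ∀ f ∈ A, (fun x => φ (f x)) ∈ A
  chain_rule : ∀ φ : ℝ → ℝ, ContDiff ℝ ∞ φ → ∀ f ∈ A, ∀ x,
    P.gen (fun y => φ (f y)) x =
      deriv φ (f x) * P.gen f x + deriv (deriv φ) (f x) * P.carreDuChamp f f x

/-- The curvature-dimension criterion `CD(ρ, ∞)`: `Γ₂(f) ≥ ρ Γ(f)` for all `f` in `A`. -/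
def CDInfty (A : Subalgebra ℝ (E → ℝ)) (ρ : ℝ) : Prop :=
  ∀ f ∈ A, ∀ x, ρ * P.carreDuChamp f f x ≤ P.gammaTwo f x

/-- `v^ε_t = -2ε log P_{εt}(e^{-f/(2ε)})`, which solves the viscous Hamilton-Jacobi equation
`∂_t v + Γ(v)/2 - ε L v = 0` with initial value `f`. -/
def viscousHJ (ε t : ℝ) (f : E → ℝ) (x : E) : ℝ :=
  -2 * ε * Real.log (P.op (ε * t) (fun y => Real.exp (-f y / (2 * ε))) x)

/-- The Hamilton-Jacobi semigroup `Q_t f`: the vanishing viscosity solution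
`Q_t f = lim_{ε → 0+} v^ε_t` of `∂_t v + Γ(v)/2 = 0`, `v_0 = f`. The lower limit, which is the limit
whenever the latter exists, makes this meaningful for all bounded `f`. -/
def hamiltonJacobi (t : ℝ) (f : E → ℝ) (x : E) : ℝ :=
  liminf (fun ε => P.viscousHJ ε t f x) (𝓝[>] (0 : ℝ))

/-- A classical solution on `[0, T]` of `∂_t v + Γ(v)/2 = 0` with `v_0 = f`: a curve in `A`,
differentiable in the sup norm, and such that `L v_s` is bounded uniformly in `s`. -/
structure IsClassicalHJ (A : Subalgebra ℝ (E → ℝ)) (T : ℝ) (f : E → ℝ) (v : ℝ → E → ℝ) : Prop where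
  initial : v 0 = f
  mem : ∀ s ∈ Icc 0 T, v s ∈ A
  equation : ∀ s ∈ Icc 0 T, ∀ η > 0, ∀ᶠ r in 𝓝[Icc 0 T] s, ∀ x,
    |v r x - v s x - (r - s) * (-(P.carreDuChamp (v s) (v s) x) / 2)| ≤ η * |r - s|
  bounded_gen : ∃ C : ℝ, ∀ s ∈ Icc 0 T, ∀ x, |P.gen (v s) x| ≤ C

section Consistency

variable {P} {A : Subalgebra ℝ (E → ℝ)}

lemma IsDiffusion.integrable (h : P.IsDiffusion A) {f : E → ℝ} (hf : f ∈ A) {t : ℝ} (ht : 0 ≤ t)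
    (x : E) : Integrable f (P.kernel t x) := by
  obtain ⟨C, hC⟩ := h.bounded f hf
  have := P.isMarkov t ht
  exact Integrable.of_bound (h.measurable f hf).aestronglyMeasurable C (ae_of_all _ hC)

lemma op_zero {f : E → ℝ} (hf : Measurable f) (x : E) : P.op 0 f x = f x := by
  unfold op
  rw [P.kernel_zero, Kernel.id_apply, integral_dirac' _ _ hf.stronglyMeasurable]

lemma IsDiffusion.op_add (h : P.IsDiffusion A) {f : E → ℝ} (hf : f ∈ A) {s t : ℝ} (hs : 0 ≤ s)
    (ht : 0 ≤ t) (x : E) : P.op (s + t) f x = P.op s (P.op t f) x := by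
  have hi := h.integrable hf (add_nonneg hs ht) x
  unfold op
  rw [P.kernel_add s t hs ht] at hi ⊢
  exact Kernel.integral_comp hi

lemma IsDiffusion.op_sub (h : P.IsDiffusion A) {f g : E → ℝ} (hf : f ∈ A) (hg : g ∈ A) {t : ℝ}
    (ht : 0 ≤ t) (x : E) : P.op t (f - g) x = P.op t f x - P.op t g x :=
  integral_sub (h.integrable hf ht x) (h.integrable hg ht x)

lemma op_const_mul (c : ℝ) (f : E → ℝ) (t : ℝ) (x : E) :
    P.op t (fun y => c * f y) x = c * P.op t f x := integral_const_mul _ _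

lemma op_mono (h : P.IsDiffusion A) {f g : E → ℝ} (hf : f ∈ A) (hg : g ∈ A) {t : ℝ}
    (ht : 0 ≤ t) (hfg : ∀ x, f x ≤ g x) (x : E) : P.op t f x ≤ P.op t g x :=
  integral_mono (h.integrable hf ht x) (h.integrable hg ht x) hfg

lemma abs_op_le {f : E → ℝ} {C t : ℝ} (ht : 0 ≤ t) (hf : ∀ x, |f x| ≤ C) (x : E) :
    |P.op t f x| ≤ C := by
  have := P.isMarkov t ht
  simpa [op] using norm_integral_le_of_norm_le_const (μ := P.kernel t x) (f := f) (C := C)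
    (ae_of_all _ hf)

lemma IsDiffusion.lipschitz (h : P.IsDiffusion A) {f : E → ℝ} (hf : f ∈ A) :
    ∃ C : ℝ, ∀ s t, 0 ≤ s → 0 ≤ t → ∀ x, |P.op s f x - P.op t f x| ≤ C * |s - t| := by
  obtain ⟨C, hC⟩ := (h.inDomain f hf).2
  have key : ∀ s t, 0 ≤ t → t ≤ s → ∀ x, |P.op s f x - P.op t f x| ≤ C * |s - t| := by
    intro s t ht hst x
    have e : P.op s f x = P.op t (P.op (s - t) f) x := by
      rw [← h.op_add hf ht (sub_nonneg.2 hst)]; congr 1; ring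
    rw [e, ← h.op_sub (h.op_mem _ (sub_nonneg.2 hst) f hf) hf ht, abs_of_nonneg (sub_nonneg.2 hst)]
    exact abs_op_le ht (fun y => hC _ (sub_nonneg.2 hst) y) x
  refine ⟨C, fun s t hs ht x => ?_⟩
  rcases le_total t s with hst | hst
  · exact key s t ht hst x
  · rw [abs_sub_comm, abs_sub_comm s]; exact key t s hs hst x

lemma IsDiffusion.continuousOn (h : P.IsDiffusion A) {f : E → ℝ} (hf : f ∈ A) (x : E) :
    ContinuousOn (fun t => P.op t f x) (Ici 0) := by
  obtain ⟨C, hC⟩ := h.lipschitz hf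
  have : LipschitzOnWith C.toNNReal (fun t => P.op t f x) (Ici 0) := by
    refine LipschitzOnWith.of_dist_le_mul fun s hs t ht => ?_
    rw [Real.dist_eq, Real.dist_eq]
    exact (hC s t hs ht x).trans
      (mul_le_mul_of_nonneg_right (Real.le_coe_toNNReal C) (abs_nonneg _))
  exact this.continuousOn

lemma IsDiffusion.exp_mem (h : P.IsDiffusion A) {f : E → ℝ} (hf : f ∈ A) (a b : ℝ) :
    (fun x => Real.exp (a * f x + b)) ∈ A :=
  h.comp_mem (fun y => Real.exp (a * y + b)) (by fun_prop) f hf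

/-- Right derivative: `∂_t P_t f = P_t L f`. -/
lemma IsDiffusion.hasDerivWithinAt_right (h : P.IsDiffusion A) {f : E → ℝ} (hf : f ∈ A) {t : ℝ}
    (ht : 0 ≤ t) (x : E) :
    HasDerivWithinAt (fun s => P.op s f x) (P.op t (P.gen f) x) (Ici t) t := by
  have := P.isMarkov t ht
  obtain ⟨C, hC⟩ := (h.inDomain f hf).2
  rw [← hasDerivWithinAt_Ioi_iff_Ici, hasDerivWithinAt_iff_tendsto_slope' (by simp)]
  have hlim : ∀ y, Tendsto (fun s => (s - t)⁻¹ * (P.op (s - t) f y - f y)) (𝓝[>] t)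
      (𝓝 (P.gen f y)) := by
    intro y
    have h0 := ((h.inDomain f hf).1 y).hasDerivWithinAt
    rw [← hasDerivWithinAt_Ioi_iff_Ici, hasDerivWithinAt_iff_tendsto_slope' (by simp)] at h0
    have hm : Tendsto (fun s : ℝ => s - t) (𝓝[>] t) (𝓝[>] 0) := by
      refine tendsto_nhdsWithin_iff.2 ⟨?_, ?_⟩
      · have : Tendsto (fun s : ℝ => s - t) (𝓝 t) (𝓝 (t - t)) :=
          (continuous_id.sub continuous_const).tendsto t
        rw [sub_self] at this
        exact this.mono_left nhdsWithin_le_nhds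
      · filter_upwards [self_mem_nhdsWithin] with s hs
        exact sub_pos.2 (mem_Ioi.1 hs)
    have := h0.comp hm
    refine this.congr fun s => ?_
    simp [slope_def_field, op_zero (h.measurable f hf), div_eq_inv_mul]
  have hdc := tendsto_integral_filter_of_dominated_convergence (μ := P.kernel t x)
    (F := fun s y => (s - t)⁻¹ * (P.op (s - t) f y - f y)) (f := P.gen f) (l := 𝓝[>] t)
    (fun _ => C) ?_ ?_ (integrable_const _) (ae_of_all _ hlim)
  · refine hdc.congr' ?_
    filter_upwards [self_mem_nhdsWithin] with s hs
    have hs' : 0 ≤ s - t := (sub_pos.2 hs).le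
    have e : P.op s f x = P.op t (P.op (s - t) f) x := by
      rw [← h.op_add hf ht hs']; congr 1; ring
    rw [slope_def_field, e, ← h.op_sub (h.op_mem _ hs' f hf) hf ht, div_eq_inv_mul]
    exact integral_const_mul _ _
  · filter_upwards [self_mem_nhdsWithin] with s hs
    have hs' : 0 ≤ s - t := (sub_pos.2 hs).le
    exact (((h.measurable _ (h.op_mem _ hs' f hf)).sub (h.measurable f hf)).const_mul
      _).aestronglyMeasurable
  · filter_upwards [self_mem_nhdsWithin] with s hs
    have hs' : 0 < s - t := sub_pos.2 hs
    refine ae_of_all _ fun y => ?_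
    rw [Real.norm_eq_abs, abs_mul, abs_of_pos (inv_pos.2 hs'), inv_mul_le_iff₀ hs', mul_comm]
    exact hC _ hs'.le y

/-- The heat equation `∂_t P_t f = P_t L f` for `t ≥ 0`. -/
lemma IsDiffusion.hasDerivWithinAt_op (h : P.IsDiffusion A) {f : E → ℝ} (hf : f ∈ A) {t : ℝ}
    (ht : 0 ≤ t) (x : E) :
    HasDerivWithinAt (fun s => P.op s f x) (P.op t (P.gen f) x) (Ici 0) t := by
  have hg := h.gen_mem f hf
  -- the integrand, extended to all times
  set k : ℝ → ℝ := fun s => P.op (max s 0) (P.gen f) x with hk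
  have hkc : Continuous k := by
    rw [← continuousOn_univ]
    exact (h.continuousOn hg x).comp (by fun_prop) fun s _ => le_max_right s 0
  have hI : ∀ s, HasDerivAt (fun u => ∫ r in (0 : ℝ)..u, k r) (k s) s := fun s =>
    intervalIntegral.integral_hasDerivAt_right (hkc.intervalIntegrable _ _)
      (hkc.stronglyMeasurableAtFilter _ _) hkc.continuousAt
  have hconst : ∀ s, 0 ≤ s → P.op s f x - ∫ r in (0 : ℝ)..s, k r = P.op 0 f x := by
    intro s hs
    have := constant_of_has_deriv_right_zero (a := 0) (b := s)
      (f := fun s => P.op s f x - ∫ r in (0 : ℝ)..s, k r)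
      (((h.continuousOn hf x).mono Icc_subset_Ici_self).sub
        fun r _ => (hI r).continuousAt.continuousWithinAt) ?_ s ⟨hs, le_rfl⟩
    · simpa using this
    · intro r hr
      have := (h.hasDerivWithinAt_right hf hr.1 x).sub (hI r).hasDerivWithinAt
      have e : k r = P.op r (P.gen f) x := by simp [hk, max_eq_left hr.1]
      rw [e, sub_self] at this
      exact this
  have h1 : HasDerivWithinAt (fun s => P.op 0 f x + ∫ r in (0 : ℝ)..s, k r) (k t) (Ici 0) t :=
    ((hI t).const_add _).hasDerivWithinAt
  have h2 : k t = P.op t (P.gen f) x := by simp [hk, max_eq_left ht]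
  rw [← h2]
  exact h1.congr (fun s hs => by rw [← hconst s hs]; ring) (by rw [← hconst t ht]; ring)

lemma IsDiffusion.hasDerivWithinAt_flow (h : P.IsDiffusion A) {ε t s : ℝ} (hε : 0 ≤ ε)
    {g : ℝ → E → ℝ} (hg : ∀ r ∈ Icc 0 t, g r ∈ A) {D : E → ℝ} (hD : D ∈ A) (hs : s ∈ Icc 0 t)
    (hder : ∀ η > 0, ∀ᶠ r in 𝓝[Icc 0 t] s, ∀ y, |g r y - g s y - (r - s) * D y| ≤ η * |r - s|)
    (x : E) :
    HasDerivWithinAt (fun r => P.op (ε * (t - r)) (g r) x)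
      (P.op (ε * (t - s)) D x - ε * P.op (ε * (t - s)) (P.gen (g s)) x) (Icc 0 t) s := by
  have hmaps : MapsTo (fun r => ε * (t - r)) (Icc 0 t) (Ici 0) := fun r hr =>
    mul_nonneg hε (sub_nonneg.2 hr.2)
  have h1 : HasDerivWithinAt (fun r => P.op (ε * (t - r)) (g s) x)
      (-(ε * P.op (ε * (t - s)) (P.gen (g s)) x)) (Icc 0 t) s := by
    have hi : HasDerivWithinAt (fun r => ε * (t - r)) (ε * (-1)) (Icc 0 t) s :=
      (((hasDerivAt_id s).const_sub t).const_mul ε).hasDerivWithinAt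
    have := HasDerivWithinAt.comp s (h.hasDerivWithinAt_op (hg s hs) (hmaps hs) x) hi hmaps
    refine (this.congr_deriv ?_)
    ring
  have hDc : ContinuousWithinAt (fun r => P.op (ε * (t - r)) D x) (Icc 0 t) s :=
    ((h.continuousOn hD x).comp (by fun_prop) hmaps) s hs
  have h2 : HasDerivWithinAt
      (fun r => P.op (ε * (t - r)) (g r) x - P.op (ε * (t - r)) (g s) x)
      (P.op (ε * (t - s)) D x) (Icc 0 t) s := by
    rw [hasDerivWithinAt_iff_isLittleO, Asymptotics.isLittleO_iff]
    intro η hη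
    filter_upwards [hder (η / 2) (by positivity), self_mem_nhdsWithin,
      Metric.continuousWithinAt_iff'.1 hDc (η / 2) (by positivity)] with r hr hrm hrD
    have hr0 : 0 ≤ ε * (t - r) := hmaps hrm
    have i1 := h.integrable (hg r hrm) hr0 x
    have i2 := h.integrable (hg s hs) hr0 x
    have i3 := (h.integrable hD hr0 x).const_mul (r - s)
    rw [Real.dist_eq] at hrD
    have e : P.op (ε * (t - r)) (g r) x - P.op (ε * (t - r)) (g s) x
        - (r - s) * P.op (ε * (t - r)) D x
        = P.op (ε * (t - r)) (fun y => g r y - g s y - (r - s) * D y) x := by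
      have j1 := integral_sub (i1.sub i2) i3
      have j2 := integral_sub i1 i2
      rw [integral_const_mul] at j1
      simp only [Pi.sub_apply] at j1
      rw [j2] at j1
      exact j1.symm
    have b1 := abs_op_le (P := P) hr0 hr x
    rw [← e] at b1
    have b2 : |(r - s) * (P.op (ε * (t - r)) D x - P.op (ε * (t - s)) D x)| ≤ η / 2 * |r - s| := by
      rw [abs_mul, mul_comm]
      exact mul_le_mul_of_nonneg_right hrD.le (abs_nonneg _)
    simp only [sub_self, sub_zero, smul_eq_mul, Real.norm_eq_abs]
    calc _ = |(P.op (ε * (t - r)) (g r) x - P.op (ε * (t - r)) (g s) x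
        - (r - s) * P.op (ε * (t - r)) D x)
        + (r - s) * (P.op (ε * (t - r)) D x - P.op (ε * (t - s)) D x)| := by congr 1; ring
      _ ≤ _ := (abs_add_le _ _).trans (by linarith)
  refine ((h1.add h2).congr_deriv (by ring)).congr (fun r _ => ?_) ?_ <;> simp

lemma IsDiffusion.carreDuChamp_mem (h : P.IsDiffusion A) {f g : E → ℝ} (hf : f ∈ A) (hg : g ∈ A) :
    P.carreDuChamp f g ∈ A := by
  have : P.carreDuChamp f g
      = (2⁻¹ : ℝ) • (P.gen (f * g) - f * P.gen g - g * P.gen f) := by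
    ext x
    simp only [carreDuChamp, Pi.smul_apply, Pi.sub_apply, Pi.mul_apply, smul_eq_mul]
    rw [div_eq_inv_mul]; rfl
  rw [this]
  exact A.smul_mem (A.sub_mem (A.sub_mem (h.gen_mem _ (A.mul_mem hf hg))
    (A.mul_mem hf (h.gen_mem _ hg))) (A.mul_mem hg (h.gen_mem _ hf))) _

lemma IsDiffusion.gen_exp (h : P.IsDiffusion A) {f : E → ℝ} (hf : f ∈ A) (a b : ℝ) (x : E) :
    P.gen (fun y => Real.exp (a * f y + b)) x =
      Real.exp (a * f x + b) * (a * P.gen f x + a ^ 2 * P.carreDuChamp f f x) := by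
  have d1 : deriv (fun z : ℝ => Real.exp (a * z + b)) = fun z => a * Real.exp (a * z + b) := by
    ext z
    have : HasDerivAt (fun z : ℝ => Real.exp (a * z + b)) (Real.exp (a * z + b) * (a * 1)) z :=
      (((hasDerivAt_id z).const_mul a).add_const b).exp
    rw [this.deriv]; ring
  have := h.chain_rule (fun z => Real.exp (a * z + b)) (by fun_prop) f hf x
  rw [this, d1, deriv_const_mul_field, d1]
  ring

/-- Comparison of a classical solution of the Hamilton-Jacobi equation with `v^ε`, up to `O(ε)`. -/
lemma IsClassicalHJ.comparison (h : P.IsDiffusion A) {T : ℝ} {f : E → ℝ} {v : ℝ → E → ℝ}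
    (hv : P.IsClassicalHJ A T f v) (hT : 0 ≤ T) {C : ℝ}
    (hC : ∀ s ∈ Icc 0 T, ∀ x, |P.gen (v s) x| ≤ C) {ε : ℝ} (hε : 0 < ε) (x : E) :
    |P.viscousHJ ε T f x - v T x| ≤ ε * C * T := by
  have hf : f ∈ A := hv.initial ▸ hv.mem 0 ⟨le_rfl, hT⟩
  set a : ℝ := -1 / (2 * ε) with ha
  have ha2 : a ^ 2 * ε = -a / 2 := by rw [ha]; field_simp
  have haε : a * ε = -1 / 2 := by rw [ha]; field_simp
  -- the derivative of the interpolation between the two functions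
  have key : ∀ σ : ℝ, ∀ s ∈ Icc 0 T, HasDerivWithinAt
      (fun r => P.op (ε * (T - r)) (fun y => Real.exp (a * v r y + σ * C / 2 * r)) x)
      (P.op (ε * (T - s)) (fun y => Real.exp (a * v s y + σ * C / 2 * s) *
        (P.gen (v s) y / 2 + σ * C / 2)) x) (Icc 0 T) s := by
    intro σ s hs
    have hvs := hv.mem s hs
    have hΓ := h.carreDuChamp_mem hvs hvs
    have hE := h.exp_mem hvs a (σ * C / 2 * s)
    set G : E → ℝ := fun y => Real.exp (a * v s y + σ * C / 2 * s) with hG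
    set W : E → ℝ := (-a / 2) • P.carreDuChamp (v s) (v s) + algebraMap ℝ (E → ℝ) (σ * C / 2)
      with hW
    have hWA : W ∈ A := A.add_mem (A.smul_mem hΓ _) (A.algebraMap_mem _)
    have hWx : ∀ y, W y = -a / 2 * P.carreDuChamp (v s) (v s) y + σ * C / 2 := fun y => rfl
    have hDA : G * W ∈ A := A.mul_mem hE hWA
    have hflow := h.hasDerivWithinAt_flow (ε := ε) (t := T) (s := s) hε.le
      (g := fun r y => Real.exp (a * v r y + σ * C / 2 * r))
      (fun r hr => h.exp_mem (hv.mem r hr) _ _) hDA hs ?_ x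
    · have hgen : P.gen G ∈ A := h.gen_mem _ hE
      refine hflow.congr_deriv ?_
      have hr0 : 0 ≤ ε * (T - s) := mul_nonneg hε.le (sub_nonneg.2 hs.2)
      change P.op (ε * (T - s)) (G * W) x - ε * P.op (ε * (T - s)) (P.gen G) x = _
      rw [← op_const_mul]
      have hεg : (fun y => ε * P.gen G y) ∈ A := A.smul_mem hgen ε
      rw [← h.op_sub hDA hεg hr0]
      congr 1
      ext y
      simp only [Pi.sub_apply, Pi.mul_apply, hWx]
      rw [hG, h.gen_exp hvs]
      linear_combination (-(Real.exp (a * v s y + σ * C / 2 * s)) *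
        P.carreDuChamp (v s) (v s) y) * ha2
        - (Real.exp (a * v s y + σ * C / 2 * s)) * P.gen (v s) y * haε
    · intro η hη
      obtain ⟨M, hM⟩ := h.bounded G hE
      obtain ⟨K, hK⟩ := h.bounded W hWA
      set M' := |M| + 1 with hM'
      set B := |a| + |K| + 1 with hB
      have hMp : 0 < M' := by positivity
      have hBp : 0 < B := by positivity
      have hap : 0 < |a| + 1 := by positivity
      set η' := min 1 (η / (2 * M' * (|a| + 1))) with hη'
      have hη'p : 0 < η' := lt_min one_pos (by positivity)
      have hη'1 : η' ≤ 1 := min_le_left _ _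
      have hη'2 : M' * (|a| * η') ≤ η / 2 := by
        have : η' * (2 * M' * (|a| + 1)) ≤ η := by
          rw [← le_div_iff₀ (by positivity)]; exact min_le_right _ _
        nlinarith [mul_pos hMp hη'p]
      have hsmall : ∀ᶠ r in 𝓝[Icc 0 T] s, |r - s| < min (1 / B) (η / (2 * M' * B ^ 2)) := by
        refine nhdsWithin_le_nhds ?_
        have := Metric.ball_mem_nhds s
          (lt_min (by positivity : 0 < 1 / B) (by positivity : 0 < η / (2 * M' * B ^ 2)))
        filter_upwards [this] with r hr
        rwa [Metric.mem_ball, Real.dist_eq] at hr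
      filter_upwards [hv.equation s hs η' hη'p, hsmall] with r hr hrs y
      set δ := r - s with hδ
      have hδ1 : B * |δ| ≤ 1 := by
        have := (hrs.trans_le (min_le_left _ _)).le
        rw [le_div_iff₀ hBp] at this; linarith
      have hδ2 : M' * (B ^ 2 * |δ|) ≤ η / 2 := by
        have := (hrs.trans_le (min_le_right _ _)).le
        rw [le_div_iff₀ (by positivity)] at this; nlinarith
      set β := a * (v r y - v s y) + σ * C / 2 * δ with hβ
      have hβ1 : |β - δ * W y| ≤ |a| * η' * |δ| := by
        have : β - δ * W y
            = a * (v r y - v s y - δ * (-(P.carreDuChamp (v s) (v s) y) / 2)) := by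
          rw [hβ, hWx]; ring
        rw [this, abs_mul, mul_assoc]
        exact mul_le_mul_of_nonneg_left (hr y) (abs_nonneg _)
      have hβ2 : |β| ≤ B * |δ| := by
        have e : β = (β - δ * W y) + δ * W y := by ring
        have hKy : |δ * W y| ≤ |K| * |δ| := by
          rw [abs_mul, mul_comm]
          exact mul_le_mul_of_nonneg_right ((hK y).trans (le_abs_self K)) (abs_nonneg _)
        rw [e]
        refine (abs_add_le _ _).trans ?_
        have : |a| * η' ≤ |a| := mul_le_of_le_one_right (abs_nonneg _) hη'1
        nlinarith [abs_nonneg δ]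
      have hexp := Real.abs_exp_sub_one_sub_id_le (hβ2.trans hδ1)
      have hsq : β ^ 2 ≤ B ^ 2 * |δ| * |δ| := by
        have := pow_le_pow_left₀ (abs_nonneg β) hβ2 2
        rw [sq_abs] at this; nlinarith
      have e1 : Real.exp (a * v r y + σ * C / 2 * r) = G y * Real.exp β := by
        rw [hG, ← Real.exp_add]; congr 1; rw [hβ, hδ]; ring
      have e2 : Real.exp (a * v r y + σ * C / 2 * r) - Real.exp (a * v s y + σ * C / 2 * s)
          - δ * (G * W) y = G y * ((Real.exp β - 1 - β) + (β - δ * W y)) := by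
        rw [e1, Pi.mul_apply]
        change G y * _ - G y - _ = _
        ring
      rw [e2, abs_mul]
      have hGM : |G y| ≤ M' := (hM y).trans ((le_abs_self M).trans (by linarith))
      calc |G y| * |(Real.exp β - 1 - β) + (β - δ * W y)|
          ≤ M' * (B ^ 2 * |δ| * |δ| + |a| * η' * |δ|) := by
            refine mul_le_mul hGM ((abs_add_le _ _).trans ?_) (abs_nonneg _) hMp.le
            exact add_le_add (hexp.trans hsq) hβ1
        _ = (M' * (B ^ 2 * |δ|) + M' * (|a| * η')) * |δ| := by ring
        _ ≤ η * |δ| := mul_le_mul_of_nonneg_right (by linarith) (abs_nonneg _)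
  have hcont : ∀ σ : ℝ, ContinuousOn
      (fun r => P.op (ε * (T - r)) (fun y => Real.exp (a * v r y + σ * C / 2 * r)) x)
      (Icc 0 T) := fun σ s hs => (key σ s hs).continuousWithinAt
  have e0 : ∀ σ : ℝ, P.op (ε * (T - 0)) (fun y => Real.exp (a * v 0 y + σ * C / 2 * 0)) x
      = P.op (ε * T) (fun y => Real.exp (-f y / (2 * ε))) x := by
    intro σ
    rw [hv.initial, sub_zero]
    congr 1
    ext y
    congr 1
    rw [ha]; ring
  have eT : ∀ σ : ℝ, P.op (ε * (T - T)) (fun y => Real.exp (a * v T y + σ * C / 2 * T)) x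
      = Real.exp (a * v T x + σ * C / 2 * T) := by
    intro σ
    rw [sub_self, mul_zero]
    exact op_zero (h.measurable _ (h.exp_mem (hv.mem T ⟨hT, le_rfl⟩) a _)) x
  set U := P.op (ε * T) (fun y => Real.exp (-f y / (2 * ε))) x with hU
  have hsub : interior (Icc 0 T) ⊆ Icc 0 T := interior_subset
  have hlow : Real.exp (a * v T x + (-1) * C / 2 * T) ≤ U := by
    have hanti := antitoneOn_of_hasDerivWithinAt_nonpos (convex_Icc 0 T) (hcont (-1))
      (fun s hs => (key (-1) s (hsub hs)).mono hsub) (fun s hs => ?_)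
    · have := hanti ⟨le_rfl, hT⟩ ⟨hT, le_rfl⟩ hT
      beta_reduce at this
      rwa [e0, eT] at this
    · refine integral_nonpos fun y => mul_nonpos_of_nonneg_of_nonpos (Real.exp_pos _).le ?_
      have := (abs_le.1 (hC s (hsub hs) y)).2
      linarith
  have hupp : U ≤ Real.exp (a * v T x + 1 * C / 2 * T) := by
    have hmono := monotoneOn_of_hasDerivWithinAt_nonneg (convex_Icc 0 T) (hcont 1)
      (fun s hs => (key 1 s (hsub hs)).mono hsub) (fun s hs => ?_)
    · have := hmono ⟨le_rfl, hT⟩ ⟨hT, le_rfl⟩ hT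
      beta_reduce at this
      rwa [e0, eT] at this
    · refine integral_nonneg fun y => mul_nonneg (Real.exp_pos _).le ?_
      have := (abs_le.1 (hC s (hsub hs) y)).1
      linarith
  have hUpos : 0 < U := (Real.exp_pos _).trans_le hlow
  have l1 := (Real.le_log_iff_exp_le hUpos).2 hlow
  have l2 := (Real.log_le_iff_le_exp hUpos).2 hupp
  have hvis : P.viscousHJ ε T f x = -2 * ε * Real.log U := rfl
  have m1 := mul_le_mul_of_nonneg_left l1 (by positivity : 0 ≤ 2 * ε)
  have m2 := mul_le_mul_of_nonneg_left l2 (by positivity : 0 ≤ 2 * ε)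
  have hav : 2 * ε * (a * v T x) = -v T x := by linear_combination 2 * v T x * haε
  rw [hvis, abs_le]
  constructor <;> nlinarith

/-- `Q_t f` is the solution of the Hamilton-Jacobi equation whenever a classical one exists. -/
theorem IsClassicalHJ.hamiltonJacobi_eq (h : P.IsDiffusion A) {T : ℝ} {f : E → ℝ}
    {v : ℝ → E → ℝ} (hv : P.IsClassicalHJ A T f v) {t : ℝ} (ht : t ∈ Icc 0 T) (x : E) :
    P.hamiltonJacobi t f x = v t x := by
  have hsub : Icc 0 t ⊆ Icc 0 T := Icc_subset_Icc_right ht.2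
  have hv' : P.IsClassicalHJ A t f v :=
    ⟨hv.initial, fun s hs => hv.mem s (hsub hs),
      fun s hs η hη => nhdsWithin_mono s hsub (hv.equation s (hsub hs) η hη),
      hv.bounded_gen.imp fun C hC s hs => hC s (hsub hs)⟩
  obtain ⟨C, hC⟩ := hv'.bounded_gen
  have hlim : Tendsto (fun ε => P.viscousHJ ε t f x) (𝓝[>] (0 : ℝ)) (𝓝 (v t x)) := by
    rw [tendsto_iff_dist_tendsto_zero]
    have h0 : Tendsto (fun ε : ℝ => ε * C * t) (𝓝[>] (0 : ℝ)) (𝓝 0) := by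
      have : Tendsto (fun ε : ℝ => ε * C * t) (𝓝 0) (𝓝 (0 * C * t)) :=
        Continuous.tendsto (by fun_prop) 0
      rw [zero_mul, zero_mul] at this
      exact this.mono_left nhdsWithin_le_nhds
    refine tendsto_of_tendsto_of_tendsto_of_le_of_le' tendsto_const_nhds h0
      (Eventually.of_forall fun _ => dist_nonneg) ?_
    filter_upwards [self_mem_nhdsWithin] with ε hε
    rw [Real.dist_eq]
    exact hv'.comparison h ht.1 hC hε x
  exact hlim.liminf_eq

lemma IsDiffusion.continuousOn_viscousHJ (h : P.IsDiffusion A) {f : E → ℝ} (hf : f ∈ A)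
    {t : ℝ} (ht : 0 ≤ t) (x : E) : ContinuousOn (fun ε => P.viscousHJ ε t f x) (Ioi 0) := by
  have hmem : ∀ ε : ℝ, (fun y => Real.exp (-f y / (2 * ε))) ∈ A := by
    intro ε
    have : (fun y => Real.exp (-f y / (2 * ε))) = fun y => Real.exp (-1 / (2 * ε) * f y + 0) := by
      ext y; congr 1; ring
    rw [this]
    exact h.exp_mem hf _ _
  have hpos : ∀ ε : ℝ, 0 < ε → 0 < P.op (ε * t) (fun y => Real.exp (-f y / (2 * ε))) x := by
    intro ε hε
    have := P.isMarkov (ε * t) (by positivity)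
    exact integral_exp_pos (h.integrable (hmem ε) (by positivity) x)
  obtain ⟨C, hC⟩ := h.bounded f hf
  have hop : ContinuousOn (fun ε => P.op (ε * t) (fun y => Real.exp (-f y / (2 * ε))) x)
      (Ioi 0) := by
    intro ε₀ hε₀
    obtain ⟨M, hM⟩ := h.bounded _ (hmem ε₀)
    set G : E → ℝ := fun y => Real.exp (-f y / (2 * ε₀)) with hG
    have c1 : ContinuousWithinAt (fun ε => P.op (ε * t) G x) (Ioi 0) ε₀ :=
      ((h.continuousOn (hmem ε₀) x).comp (g := fun s => P.op s G x) (f := fun ε => ε * t)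
        (s := Ioi 0) (by fun_prop) fun ε hε => mul_nonneg (le_of_lt hε) ht) ε₀ hε₀
    have hε₀' : (0 : ℝ) < ε₀ := hε₀
    have hb : Tendsto (fun ε : ℝ => |1 / (2 * ε₀) - 1 / (2 * ε)| * |C|) (𝓝[Ioi 0] ε₀) (𝓝 0) := by
      have : ContinuousAt (fun ε : ℝ => |1 / (2 * ε₀) - 1 / (2 * ε)| * |C|) ε₀ := by
        have : 2 * ε₀ ≠ 0 := by positivity
        fun_prop (disch := assumption)
      have := this.tendsto
      rw [sub_self, abs_zero, zero_mul] at this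
      exact this.mono_left nhdsWithin_le_nhds
    have c2 : Tendsto (fun ε => P.op (ε * t) (fun y => Real.exp (-f y / (2 * ε))) x
        - P.op (ε * t) G x) (𝓝[Ioi 0] ε₀) (𝓝 0) := by
      have hb' := (hb.const_mul (|M| * 2))
      rw [mul_zero] at hb'
      refine squeeze_zero_norm' ?_ hb'
      filter_upwards [self_mem_nhdsWithin, hb.eventually (gt_mem_nhds one_pos)] with ε hε hε1
      have hr0 : 0 ≤ ε * t := mul_nonneg (le_of_lt hε) ht
      rw [← h.op_sub (hmem ε) (hmem ε₀) hr0, Real.norm_eq_abs]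
      refine abs_op_le hr0 (fun y => ?_) x
      set β := (1 / (2 * ε₀) - 1 / (2 * ε)) * f y with hβ
      have hβ1 : |β| ≤ |1 / (2 * ε₀) - 1 / (2 * ε)| * |C| := by
        rw [hβ, abs_mul]
        exact mul_le_mul_of_nonneg_left ((hC y).trans (le_abs_self C)) (abs_nonneg _)
      have e : ((fun y => Real.exp (-f y / (2 * ε))) - G) y = G y * (Real.exp β - 1) := by
        simp only [Pi.sub_apply, hG, mul_sub, ← Real.exp_add, mul_one]
        congr 2
        rw [hβ]; ring
      rw [e, abs_mul, mul_assoc]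
      refine mul_le_mul ((hM y).trans (le_abs_self M)) ?_ (abs_nonneg _) (abs_nonneg _)
      exact (Real.abs_exp_sub_one_le (hβ1.trans hε1.le)).trans (by linarith)
    have c3 := c2.add c1.tendsto
    rw [zero_add] at c3
    exact c3.congr fun ε => by ring
  unfold viscousHJ
  exact (by fun_prop : ContinuousOn (fun ε : ℝ => -2 * ε) (Ioi 0)).mul
    (hop.log fun ε hε => (hpos ε hε).ne')

/-- `Q_t f` is measurable. -/
theorem IsDiffusion.measurable_hamiltonJacobi (h : P.IsDiffusion A) {f : E → ℝ} (hf : f ∈ A)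
    {t : ℝ} (ht : 0 ≤ t) : Measurable (P.hamiltonJacobi t f) := by
  have hev : ∀ (x : E) (a : ℝ), (∀ᶠ ε in 𝓝[>] (0 : ℝ), a ≤ P.viscousHJ ε t f x) ↔
      ∀ᶠ q : ℚ in comap ((↑) : ℚ → ℝ) (𝓝[>] (0 : ℝ)), a ≤ P.viscousHJ (q : ℝ) t f x := by
    intro x a
    refine ⟨fun H => H.comap _, fun H => ?_⟩
    have hbasis := (nhdsGT_basis (0 : ℝ)).comap ((↑) : ℚ → ℝ)
    obtain ⟨δ, hδ, hq⟩ := hbasis.eventually_iff.1 H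
    refine (nhdsGT_basis (0 : ℝ)).eventually_iff.2 ⟨δ, hδ, fun ε hε => ?_⟩
    have hc : ContinuousOn (fun ε => P.viscousHJ ε t f x) (Ioo 0 δ) :=
      (h.continuousOn_viscousHJ hf ht x).mono Ioo_subset_Ioi_self
    set R : Set ℝ := range (fun q : ℚ => (q : ℝ)) with hR
    have hcl : ε ∈ closure (Ioo 0 δ ∩ R) :=
      Dense.open_subset_closure_inter Rat.denseRange_cast isOpen_Ioo hε
    have hne : (𝓝[Ioo 0 δ ∩ R] ε).NeBot := mem_closure_iff_nhdsWithin_neBot.1 hcl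
    have hcw : ContinuousWithinAt (fun ε => P.viscousHJ ε t f x) (Ioo 0 δ ∩ R) ε :=
      (hc ε hε).mono inter_subset_left
    refine ge_of_tendsto hcw.tendsto ?_
    filter_upwards [self_mem_nhdsWithin] with r hr
    obtain ⟨hr1, q, rfl⟩ := hr
    exact hq hr1
  have hQ : P.hamiltonJacobi t f = fun x => liminf (fun q : ℚ => P.viscousHJ (q : ℝ) t f x)
      (comap ((↑) : ℚ → ℝ) (𝓝[>] (0 : ℝ))) := by
    ext x
    simp only [hamiltonJacobi, liminf_eq, hev]
  rw [hQ]
  have hm : ∀ q : ℚ, Measurable fun x => P.viscousHJ (q : ℝ) t f x := by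
    intro q
    unfold viscousHJ op
    have hg : Measurable fun y => Real.exp (-f y / (2 * (q : ℝ))) := by
      have := h.measurable f hf
      fun_prop
    have : Measurable fun x => ∫ y, Real.exp (-f y / (2 * (q : ℝ))) ∂(P.kernel (q * t) x) :=
      (hg.stronglyMeasurable.integral_kernel (κ := P.kernel (q * t))).measurable
    exact (this.log).const_mul _
  obtain ⟨u, hu⟩ := (comap ((↑) : ℚ → ℝ) (𝓝[>] (0 : ℝ))).exists_antitone_basis
  exact Measurable.liminf' hm ⟨hu.1, to_countable _⟩ fun j => to_countable _

end Consistency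

end MarkovSemigroup

end

/-!
Both properties are equivalent to the local logarithmic Sobolev inequalities
`P_u(f e^f) - P_u(e^f) log P_u(e^f) ≤ c(u) P_u(e^f Γ(f))`, where `c(u) = ∫₀ᵘ e^{-2ρs} ds`.

With `w_r = log P_r(e^f)`, the first two derivatives in `r` of `P_{u-r}(e^{w_r} w_r)` are
`-P_{u-r}(e^{w_r} Γ(w_r))` and `2 P_{u-r}(e^{w_r} Γ₂(w_r))`, so that `CD(ρ, ∞)` becomes a
differential inequality whose integrated form is the local inequality. Conversely the local
inequality is an equality to first order at `u = 0`, and comparing the second order terms gives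
`Γ₂(f) ≥ ρ Γ(f)`.

Along the viscous Hamilton-Jacobi flow, put `q(s) = q₂ + s / (2c)` with `c = c(u)`. The local
inequality makes `s ↦ P_{u-εs}(e^{q(s) v^ε_s})^{1/q(s)}` nonincreasing, and hypercontractivity
follows by Fatou's lemma as `ε → 0`. In the other direction `Q_t f ≥ f - t Γ(f) / 2 - K t²`, because
the right-hand side is, up to an error of order `ε`, a subsolution of the viscous equation;
inserting this into hypercontractivity and differentiating at `t = 0` returns the local inequality.
-/

open Asymptotics

lemma deriv_nonpos_of_isLocalMaxOn {f : ℝ → ℝ} {d a : ℝ} {S : Set ℝ} (hS : a ∈ closure (Ioi a ∩ S))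
    (hf : HasDerivWithinAt f d S a) (hmax : IsLocalMaxOn f S a) : d ≤ 0 := by
  simpa using hmax.hasFDerivWithinAt_nonpos hf.hasFDerivWithinAt
    (one_mem_posTangentConeAt_iff_mem_closure.2 hS)

lemma mem_closure_Ioi_inter_Ici (a : ℝ) : a ∈ closure (Ioi a ∩ Ici a) := by
  rw [inter_eq_left.2 Ioi_subset_Ici_self, closure_Ioi]
  exact self_mem_Ici

lemma mem_closure_Ioi_inter_Icc {a b : ℝ} (hab : a < b) : a ∈ closure (Ioi a ∩ Icc a b) := by
  have : Ioi a ∩ Icc a b = Ioc a b := by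
    ext t
    grind
  rw [this, closure_Ioc hab.ne]
  exact left_mem_Icc.2 hab.le

lemma second_deriv_nonpos_of_isLocalMaxOn {f f' : ℝ → ℝ} {d a : ℝ}
    (hf : ∀ t ∈ Ici a, HasDerivWithinAt f (f' t) (Ici a) t) (hf'a : f' a = 0)
    (hd : HasDerivWithinAt f' d (Ici a) a) (hmax : IsLocalMaxOn f (Ici a) a) : d ≤ 0 := by
  by_contra! hd_pos
  have hslope := (hasDerivWithinAt_iff_tendsto_slope' self_notMem_Ioi).1 hd.Ioi_of_Ici
  have hpos : ∀ᶠ t in 𝓝[>] a, 0 < f' t := by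
    filter_upwards [hslope.eventually_const_lt hd_pos, self_mem_nhdsWithin] with t ht hat
    rw [slope_def_field, hf'a, sub_zero] at ht
    exact (div_pos_iff_of_pos_right (sub_pos.2 hat)).1 ht
  obtain ⟨b, hab, hb⟩ := mem_nhdsGT_iff_exists_Ioo_subset.1 hpos
  have hmono : StrictMonoOn f (Ico a b) := by
    refine strictMonoOn_of_hasDerivWithinAt_pos (f' := f') (convex_Ico a b)
      (fun t ht => ((hf t ht.1).mono Ico_subset_Ici_self).continuousWithinAt) (fun t ht => ?_)
      fun t ht => hb (interior_Ico (a := a) (b := b) ▸ ht)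
    rw [interior_Ico] at ht ⊢
    exact (hf t ht.1.le).mono (Ioo_subset_Ico_self.trans Ico_subset_Ici_self)
  obtain ⟨t, hle, hat, htb⟩ :=
    ((hmax.filter_mono (nhdsWithin_mono a Ioi_subset_Ici_self)).and
      (Ioo_mem_nhdsGT hab)).exists
  exact hle.not_gt (hmono ⟨le_rfl, hab⟩ ⟨hat.le, htb⟩ hat)

/-- `f` has the second order Taylor (Peano) expansion
`f s = f r + a₁ (s - r) + a₂ (s - r)² / 2 + o((s - r)²)` at `r` along `S`. This requires less than
the existence of `f'` near `r`. -/
def HasTaylorTwoWithinAt (f : ℝ → ℝ) (a₁ a₂ : ℝ) (S : Set ℝ) (r : ℝ) : Prop :=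
  (fun s => f s - f r - (s - r) * a₁ - (s - r) ^ 2 / 2 * a₂) =o[𝓝[S] r] fun s => (s - r) ^ 2

namespace HasTaylorTwoWithinAt

variable {f g : ℝ → ℝ} {a₁ a₂ b₁ b₂ r : ℝ} {S : Set ℝ}

lemma hasDerivWithinAt (h : HasTaylorTwoWithinAt f a₁ a₂ S r) : HasDerivWithinAt f a₁ S r := by
  have hδ : Tendsto (fun s => s - r) (𝓝[S] r) (𝓝 0) := by
    simpa using tendsto_sub_nhds_zero_iff.2 (tendsto_id.mono_left nhdsWithin_le_nhds)
  have hsq : (fun s => (s - r) ^ 2) =o[𝓝[S] r] fun s => s - r := by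
    simpa [sq] using ((isLittleO_one_iff ℝ).2 hδ).mul_isBigO (isBigO_refl (fun s => s - r) _)
  rw [hasDerivWithinAt_iff_isLittleO]
  refine ((h.trans hsq).add (hsq.const_mul_left (a₂ / 2))).congr_left fun s => ?_
  rw [smul_eq_mul]
  ring

lemma sub (hf : HasTaylorTwoWithinAt f a₁ a₂ S r) (hg : HasTaylorTwoWithinAt g b₁ b₂ S r) :
    HasTaylorTwoWithinAt (fun s => f s - g s) (a₁ - b₁) (a₂ - b₂) S r :=
  (IsLittleO.sub hf hg).congr_left fun s => by ring

lemma of_hasDerivAt {f' : ℝ → ℝ} (hf : ∀ s, HasDerivAt f (f' s) s) (hf' : HasDerivAt f' a₂ r) :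
    HasTaylorTwoWithinAt f (f' r) a₂ S r := by
  have hderiv : ∀ s ∈ univ, HasDerivWithinAt (fun s => f s - (s - r) * f' r - (s - r) ^ 2 / 2 * a₂)
      (f' s - f' r - (s - r) * a₂) univ s := fun s _ => by
    have hδ := (hasDerivAt_id' s).sub_const r
    refine (((hf s).sub (hδ.mul_const (f' r))).sub
      (((hδ.pow 2).div_const 2).mul_const a₂)).hasDerivWithinAt.congr_deriv ?_
    simp only [Nat.cast_ofNat, Nat.add_one_sub_one, pow_one]
    ring
  have hrem := (hasDerivAt_iff_isLittleO.1 hf').congr_right fun s => (pow_one (s - r)).symm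
  simp only [smul_eq_mul, ← nhdsWithin_univ] at hrem
  refine ((convex_univ.isLittleO_pow_succ_real (mem_univ r) hderiv hrem).mono
    (nhdsWithin_mono r (subset_univ S))).congr_left fun s => ?_
  simp only [sub_self]
  ring

lemma congr (h : HasTaylorTwoWithinAt f a₁ a₂ S r) (hfg : EqOn g f S) (hr : r ∈ S) :
    HasTaylorTwoWithinAt g a₁ a₂ S r := by
  refine IsLittleO.congr' h ?_ .rfl
  filter_upwards [self_mem_nhdsWithin] with s hs
  rw [hfg hs, hfg hr]

lemma of_isBigO (h : (fun s => f s - f r - (s - r) * a₁ - (s - r) ^ 2 / 2 * a₂)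
    =O[𝓟 S] fun s => (s - r) ^ 3) : HasTaylorTwoWithinAt f a₁ a₂ S r := by
  have hlt : (fun s => (s - r) ^ 3) =o[𝓝[S] r] fun s => (s - r) ^ 2 := by
    simpa only [← norm_pow, isLittleO_norm_left, isLittleO_norm_right] using
      (isLittleO_pow_sub_pow_sub r (by norm_num : 2 < 3)).mono nhdsWithin_le_nhds
  exact (h.mono inf_le_right).trans_isLittleO hlt

lemma eq_zero_of_isLocalMax (hS : S ∈ 𝓝 r) (h : HasTaylorTwoWithinAt f a₁ a₂ S r)
    (hmax : IsLocalMax f r) : a₁ = 0 :=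
  hmax.hasDerivAt_eq_zero (h.hasDerivWithinAt.hasDerivAt hS)

lemma nonpos_of_isLocalMax (hS : S ∈ 𝓝 r) (h : HasTaylorTwoWithinAt f a₁ a₂ S r)
    (hmax : IsLocalMax f r) : a₂ ≤ 0 := by
  have h₁ := h.eq_zero_of_isLocalMax hS hmax
  by_contra! hpos
  rw [HasTaylorTwoWithinAt, nhdsWithin_eq_nhds.2 hS] at h
  obtain ⟨s, ⟨hs, hle⟩, hne⟩ := (((h.def (show 0 < a₂ / 4 by positivity)).and hmax).filter_mono
    nhdsWithin_le_nhds |>.and (self_mem_nhdsWithin (s := {r}ᶜ))).exists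
  have hsq : 0 < (s - r) ^ 2 := by
    have := sub_ne_zero.2 hne
    positivity
  rw [h₁, Real.norm_eq_abs, Real.norm_of_nonneg hsq.le] at hs
  nlinarith [(abs_le.1 hs).1, mul_pos hpos hsq]

end HasTaylorTwoWithinAt

/-- The constant `c(u) = ∫₀ᵘ e^{-2ρs} ds` of the local logarithmic Sobolev inequality at time `u`
under curvature bounded below by `ρ`. -/
noncomputable def sobolevConst (ρ u : ℝ) : ℝ := ∫ s in (0)..u, Real.exp (-2 * ρ * s)

lemma hasDerivAt_exp_const_mul (c s : ℝ) :
    HasDerivAt (fun s => Real.exp (c * s)) (c * Real.exp (c * s)) s := by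
  simpa [mul_comm] using ((hasDerivAt_id' s).const_mul c).exp

lemma hasDerivAt_sobolevConst (ρ u : ℝ) :
    HasDerivAt (sobolevConst ρ) (Real.exp (-2 * ρ * u)) u :=
  (show Continuous fun s => Real.exp (-2 * ρ * s) by fun_prop).integral_hasStrictDerivAt 0 u
    |>.hasDerivAt

@[simp]
lemma sobolevConst_zero (ρ : ℝ) : sobolevConst ρ 0 = 0 := intervalIntegral.integral_same

lemma strictMono_sobolevConst (ρ : ℝ) : StrictMono (sobolevConst ρ) :=
  strictMono_of_hasDerivAt_pos (hasDerivAt_sobolevConst ρ) fun _ => Real.exp_pos _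

lemma sobolevConst_pos (ρ : ℝ) {u : ℝ} (hu : 0 < u) : 0 < sobolevConst ρ u :=
  sobolevConst_zero ρ ▸ strictMono_sobolevConst ρ hu

lemma sobolevConst_zero_left (u : ℝ) : sobolevConst 0 u = u := by
  simp [sobolevConst]

lemma sobolevConst_of_ne_zero {ρ : ℝ} (hρ : ρ ≠ 0) (u : ℝ) :
    sobolevConst ρ u = (1 - Real.exp (-2 * ρ * u)) / (2 * ρ) := by
  rw [sobolevConst, intervalIntegral.integral_comp_mul_left (fun s => Real.exp s)
    (by simpa using hρ), integral_exp]
  simp only [mul_zero, Real.exp_zero, smul_eq_mul]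
  field_simp
  ring

/-- A strict supersolution of `y'' + 2ρ y' = 0` differs from `F` by a function which has no maximum
inside `[0, u]`, nor at `0` where its derivative is positive. -/
lemma isMaxOn_sub_right_endpoint {ρ u : ℝ} (hu : 0 ≤ u) {F a₁ a₂ H H' H'' : ℝ → ℝ}
    (hF : ∀ r ∈ Icc 0 u, HasTaylorTwoWithinAt F (a₁ r) (a₂ r) (Icc 0 u) r)
    (ha : ∀ r ∈ Icc 0 u, -2 * ρ * a₁ r ≤ a₂ r) (hH : ∀ r, HasDerivAt H (H' r) r)
    (hH' : ∀ r, HasDerivAt H' (H'' r) r) (hsuper : ∀ r, H'' r < -2 * ρ * H' r)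
    (h₀ : H' 0 < a₁ 0) : IsMaxOn (fun s => F s - H s) (Icc 0 u) u := by
  have hG : ∀ r ∈ Icc 0 u, HasTaylorTwoWithinAt (fun s => F s - H s) (a₁ r - H' r)
      (a₂ r - H'' r) (Icc 0 u) r := fun r hr => (hF r hr).sub (.of_hasDerivAt hH (hH' r))
  obtain ⟨r, hr, hmax⟩ := isCompact_Icc.exists_isMaxOn (nonempty_Icc.2 hu)
    fun r hr => (hG r hr).hasDerivWithinAt.continuousWithinAt
  rcases eq_or_lt_of_le hr.2 with rfl | hru
  · exact hmax
  exfalso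
  rcases eq_or_lt_of_le hr.1 with rfl | hr0
  · have := deriv_nonpos_of_isLocalMaxOn (mem_closure_Ioi_inter_Icc hru)
      (hG 0 hr).hasDerivWithinAt hmax.localize
    linarith
  · have hnhds := Icc_mem_nhds hr0 hru
    have hfirst := (hG r hr).eq_zero_of_isLocalMax hnhds (hmax.isLocalMax hnhds)
    have hsecond := (hG r hr).nonpos_of_isLocalMax hnhds (hmax.isLocalMax hnhds)
    have hmono := ha r hr
    rw [sub_eq_zero.1 hfirst] at hmono
    linarith [hsuper r]

lemma add_mul_sobolevConst_le {ρ u : ℝ} (hu : 0 ≤ u) {F a₁ a₂ : ℝ → ℝ}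
    (hF : ∀ r ∈ Icc 0 u, HasTaylorTwoWithinAt F (a₁ r) (a₂ r) (Icc 0 u) r)
    (ha : ∀ r ∈ Icc 0 u, -2 * ρ * a₁ r ≤ a₂ r) :
    F 0 + a₁ 0 * sobolevConst ρ u ≤ F u := by
  set K : ℝ := 2 * |ρ| + 1
  have hK : 0 < K := by positivity
  have hKρ : 0 < K + 2 * ρ := by linarith [neg_abs_le ρ]
  have hη : ∀ η > 0, F 0 + a₁ 0 * sobolevConst ρ u ≤ F u + η * (Real.exp (K * u) - 1) := by
    intro η hη
    have hmax := isMaxOn_sub_right_endpoint hu hF ha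
      (fun r => ((hasDerivAt_sobolevConst ρ r).const_mul (a₁ 0)).fun_sub
        ((hasDerivAt_exp_const_mul K r).const_mul η))
      (fun r => ((hasDerivAt_exp_const_mul (-2 * ρ) r).const_mul (a₁ 0)).fun_sub
        (((hasDerivAt_exp_const_mul K r).const_mul K).const_mul η))
      (fun r => by
        have : 0 < η * K * (K + 2 * ρ) * Real.exp (K * r) := by positivity
        linarith)
      (by simpa using mul_pos hη hK)
    have := hmax (left_mem_Icc.2 hu)
    simp only [mem_ofPred_eq, sobolevConst_zero, mul_zero, Real.exp_zero] at this
    linarith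
  have hlim : Tendsto (fun η => F u + η * (Real.exp (K * u) - 1)) (𝓝[>] 0) (𝓝 (F u)) := by
    have : Continuous fun η => F u + η * (Real.exp (K * u) - 1) := by fun_prop
    simpa using (this.tendsto 0).mono_left nhdsWithin_le_nhds
  exact ge_of_tendsto hlim (eventually_mem_nhdsWithin.mono hη)

lemma abs_sub_le_mul_pow_of_abs_deriv_le {S : Set ℝ} (hS : Convex ℝ S) {f f' : ℝ → ℝ} {a b C : ℝ}
    {n : ℕ} (hf : ∀ x ∈ S, HasDerivWithinAt f (f' x) S x)
    (hbound : ∀ x ∈ S, |f' x| ≤ C * |x - a| ^ n) (ha : a ∈ S) (hb : b ∈ S) :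
    |f b - f a| ≤ C * |b - a| ^ (n + 1) := by
  rcases eq_or_ne b a with rfl | hne
  · simp
  have hC : 0 ≤ C := nonneg_of_mul_nonneg_left ((abs_nonneg _).trans (hbound b hb))
    (pow_pos (abs_pos.2 (sub_ne_zero.2 hne)) n)
  have hseg : uIcc a b ⊆ S := segment_eq_uIcc a b ▸ hS.segment_subset ha hb
  have hle : ∀ x ∈ uIcc a b, ‖f' x‖ ≤ C * |b - a| ^ n := fun x hx =>
    (hbound x (hseg hx)).trans (by gcongr C * ?_ ^ n; exact abs_sub_left_of_mem_uIcc hx)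
  rw [pow_succ, ← mul_assoc]
  exact (convex_uIcc a b).norm_image_sub_le_of_norm_hasDerivWithin_le
    (fun x hx => (hf x (hseg hx)).mono hseg) hle left_mem_uIcc right_mem_uIcc

section Taylor

variable {S : Set ℝ} {f f' f'' : ℝ → ℝ} {C a b : ℝ}

lemma abs_taylor_one_le_of_lipschitz (hS : Convex ℝ S)
    (hf : ∀ x ∈ S, HasDerivWithinAt f (f' x) S x)
    (hLip : ∀ x ∈ S, ∀ y ∈ S, |f' x - f' y| ≤ C * |x - y|) (ha : a ∈ S) (hb : b ∈ S) :
    |f b - f a - (b - a) * f' a| ≤ C * |b - a| ^ 2 := by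
  have hrem := abs_sub_le_mul_pow_of_abs_deriv_le (n := 1) (C := C) hS
    (fun x hx => ((hf x hx).fun_sub
      ((((hasDerivAt_id' x).sub_const a).mul_const (f' a)).hasDerivWithinAt)))
    (fun x hx => by rw [one_mul, pow_one]; exact hLip x hx a ha) ha hb
  rwa [sub_self, zero_mul, sub_zero, sub_right_comm] at hrem

lemma abs_taylor_two_le_of_lipschitz (hS : Convex ℝ S)
    (hf : ∀ x ∈ S, HasDerivWithinAt f (f' x) S x) (hf' : ∀ x ∈ S, HasDerivWithinAt f' (f'' x) S x)
    (hLip : ∀ x ∈ S, ∀ y ∈ S, |f'' x - f'' y| ≤ C * |x - y|) (ha : a ∈ S) (hb : b ∈ S) :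
    |f b - f a - (b - a) * f' a - (b - a) ^ 2 / 2 * f'' a| ≤ C * |b - a| ^ 3 := by
  have hδ : ∀ x, HasDerivWithinAt (fun x => x - a) 1 S x :=
    fun x => ((hasDerivAt_id' x).sub_const a).hasDerivWithinAt
  have hrem := abs_sub_le_mul_pow_of_abs_deriv_le (n := 2) (C := C) hS
    (fun x hx => ((hf x hx).fun_sub ((hδ x).mul_const (f' a))).fun_sub
      ((((hδ x).fun_pow 2).div_const 2).mul_const (f'' a)))
    (fun x hx => by
      convert abs_taylor_one_le_of_lipschitz hS hf' hLip ha hx using 2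
      push_cast
      ring) ha hb
  convert hrem using 2
  ring

end Taylor

lemma exists_lipschitz_on_Icc {φ : ℝ → ℝ} (hφ : ContDiff ℝ 1 φ) (M : ℝ) :
    ∃ C : ℝ, ∀ x ∈ Icc (-M) M, ∀ y ∈ Icc (-M) M, |φ x - φ y| ≤ C * |x - y| := by
  obtain ⟨C, hC⟩ := LocallyLipschitzOn.exists_lipschitzOnWith_of_compact (isCompact_Icc (a := -M))
    (hφ.locallyLipschitz.locallyLipschitzOn (s := Icc (-M) M))
  exact ⟨C, fun x hx y hy => by simpa [Real.dist_eq] using hC.dist_le_mul x hx y hy⟩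

section Composition

variable {α : Type*} {l : Filter α} {u v : α → ℝ} {φ : ℝ → ℝ}

lemma exists_eventually_mem_Icc_of_isBigO_one (hu : u =O[l] fun _ => (1 : ℝ))
    (hv : v =O[l] fun _ => (1 : ℝ)) : ∃ M : ℝ, ∀ᶠ p in l, u p ∈ Icc (-M) M ∧ v p ∈ Icc (-M) M := by
  obtain ⟨M, hM⟩ := hu.bound
  obtain ⟨N, hN⟩ := hv.bound
  refine ⟨max M N, (hM.and hN).mono fun p hp => ?_⟩
  rw [norm_one, mul_one, mul_one, Real.norm_eq_abs, Real.norm_eq_abs] at hp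
  exact ⟨abs_le.1 (hp.1.trans (le_max_left M N)), abs_le.1 (hp.2.trans (le_max_right M N))⟩

lemma isBigO_one_mul (hu : u =O[l] fun _ => (1 : ℝ)) (hv : v =O[l] fun _ => (1 : ℝ)) :
    (fun p => u p * v p) =O[l] fun _ => (1 : ℝ) :=
  (hu.mul hv).congr_right fun _ => mul_one 1

lemma isBigO_one_comp (hφ : Continuous φ) (hu : u =O[l] fun _ => (1 : ℝ)) :
    (fun p => φ (u p)) =O[l] fun _ => (1 : ℝ) := by
  obtain ⟨M, hM⟩ := exists_eventually_mem_Icc_of_isBigO_one hu hu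
  obtain ⟨C, hC⟩ := (isCompact_Icc (a := -M) (b := M)).exists_bound_of_continuousOn hφ.continuousOn
  exact .of_bound C (hM.mono fun p hp => by simpa using hC _ hp.1)

lemma isBigO_comp_taylor_one (hφ : ContDiff ℝ 2 φ) (hu : u =O[l] fun _ => (1 : ℝ))
    (hv : v =O[l] fun _ => (1 : ℝ)) :
    (fun p => φ (v p) - φ (u p) - (v p - u p) * deriv φ (u p))
      =O[l] fun p => (v p - u p) ^ 2 := by
  obtain ⟨M, hM⟩ := exists_eventually_mem_Icc_of_isBigO_one hu hv
  obtain ⟨C, hC⟩ := exists_lipschitz_on_Icc (hφ.deriv' (n := 1)) M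
  refine .of_bound C (hM.mono fun p hp => ?_)
  rw [norm_pow]
  exact abs_taylor_one_le_of_lipschitz (convex_Icc (-M) M)
    (fun x _ => (hφ.differentiable (by simp) x).hasDerivAt.hasDerivWithinAt) hC hp.1 hp.2

lemma isBigO_comp_taylor_two (hφ : ContDiff ℝ 3 φ) (hu : u =O[l] fun _ => (1 : ℝ))
    (hv : v =O[l] fun _ => (1 : ℝ)) :
    (fun p => φ (v p) - φ (u p) - (v p - u p) * deriv φ (u p)
      - (v p - u p) ^ 2 / 2 * deriv (deriv φ) (u p)) =O[l] fun p => (v p - u p) ^ 3 := by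
  obtain ⟨M, hM⟩ := exists_eventually_mem_Icc_of_isBigO_one hu hv
  have hφ' : ContDiff ℝ 2 (deriv φ) := hφ.deriv' (n := 2)
  obtain ⟨C, hC⟩ := exists_lipschitz_on_Icc (hφ'.deriv' (n := 1)) M
  refine .of_bound C (hM.mono fun p hp => ?_)
  rw [norm_pow]
  exact abs_taylor_two_le_of_lipschitz (convex_Icc (-M) M)
    (fun x _ => (hφ.differentiable (by simp) x).hasDerivAt.hasDerivWithinAt)
    (fun x _ => (hφ'.differentiable (by simp) x).hasDerivAt.hasDerivWithinAt) hC hp.1 hp.2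

end Composition

lemma exists_contDiff_eqOn_log {m : ℝ} (hm : 0 < m) :
    ∃ φ : ℝ → ℝ, ContDiff ℝ ∞ φ ∧ EqOn φ Real.log (Ioi m) := by
  refine ⟨fun z => Real.smoothTransition (2 * z / m - 1) * Real.log z, ?_, fun z hz => ?_⟩
  · rw [contDiff_iff_contDiffAt]
    intro z
    rcases lt_or_ge z (m / 2) with hz | hz
    · refine (contDiffAt_const (c := (0 : ℝ))).congr_of_eventuallyEq ?_
      filter_upwards [gt_mem_nhds hz] with y hy
      have hy0 : 2 * y / m - 1 ≤ 0 := by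
        rw [sub_nonpos, div_le_one hm]
        linarith
      rw [Real.smoothTransition.zero_of_nonpos hy0, zero_mul]
    · have hz0 : z ≠ 0 := by linarith
      exact (Real.smoothTransition.contDiff.contDiffAt.comp z
        (by fun_prop : ContDiffAt ℝ ∞ (fun z => 2 * z / m - 1) z)).mul (Real.contDiffAt_log.2 hz0)
  · have hz1 : 1 ≤ 2 * z / m - 1 := by
      rw [le_sub_iff_add_le, le_div_iff₀ hm]
      linarith [mem_Ioi.1 hz]
    simp only [Real.smoothTransition.one_of_one_le hz1, one_mul]

namespace MarkovSemigroup

variable {E : Type*} [MeasurableSpace E] {P : MarkovSemigroup E} {A : Subalgebra ℝ (E → ℝ)}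

lemma const_mem {X : Type*} (B : Subalgebra ℝ (X → ℝ)) (c : ℝ) : (fun _ => c) ∈ B :=
  B.algebraMap_mem c

lemma op_const {t : ℝ} (ht : 0 ≤ t) (c : ℝ) (x : E) : P.op t (fun _ => c) x = c := by
  have := P.isMarkov t ht
  simp [op]

lemma IsDiffusion.op_add_fun (h : P.IsDiffusion A) {f g : E → ℝ} (hf : f ∈ A) (hg : g ∈ A) {t : ℝ}
    (ht : 0 ≤ t) (x : E) : P.op t (f + g) x = P.op t f x + P.op t g x :=
  integral_add (h.integrable hf ht x) (h.integrable hg ht x)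

lemma op_smul (c : ℝ) (f : E → ℝ) (t : ℝ) (x : E) : P.op t (c • f) x = c * P.op t f x :=
  op_const_mul c f t x

lemma gen_eq_of_hasDerivWithinAt {f : E → ℝ} {x : E} {d : ℝ}
    (h : HasDerivWithinAt (fun t => P.op t f x) d (Ici 0) 0) : P.gen f x = d :=
  h.derivWithin (uniqueDiffOn_Ici (0 : ℝ) 0 self_mem_Ici)

lemma gen_const (c : ℝ) : P.gen (fun _ => c) = 0 := by
  ext x
  exact gen_eq_of_hasDerivWithinAt ((hasDerivWithinAt_const (0 : ℝ) (Ici 0) c).congr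
    (fun t ht => op_const ht c x) (op_const le_rfl c x))

lemma gen_mul (f g : E → ℝ) :
    P.gen (f * g) = f * P.gen g + g * P.gen f + (2 : ℝ) • P.carreDuChamp f g := by
  ext x
  simp only [carreDuChamp, Pi.add_apply, Pi.mul_apply, Pi.smul_apply, smul_eq_mul,
    show (fun y => f y * g y) = f * g from rfl]
  ring

lemma carreDuChamp_comm (f g : E → ℝ) : P.carreDuChamp f g = P.carreDuChamp g f := by
  ext x
  simp only [carreDuChamp, mul_comm (f _) (g _)]
  ring

namespace IsDiffusion

lemma hasDerivWithinAt_gen (h : P.IsDiffusion A) {f : E → ℝ} (hf : f ∈ A) (x : E) :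
    HasDerivWithinAt (fun t => P.op t f x) (P.gen f x) (Ici 0) 0 :=
  ((h.inDomain f hf).1 x).hasDerivWithinAt

lemma gen_add (h : P.IsDiffusion A) {f g : E → ℝ} (hf : f ∈ A) (hg : g ∈ A) :
    P.gen (f + g) = P.gen f + P.gen g := by
  ext x
  exact gen_eq_of_hasDerivWithinAt (((h.hasDerivWithinAt_gen hf x).add
    (h.hasDerivWithinAt_gen hg x)).congr (fun t ht => h.op_add_fun hf hg ht x)
    (h.op_add_fun hf hg le_rfl x))

lemma gen_smul (h : P.IsDiffusion A) {f : E → ℝ} (hf : f ∈ A) (c : ℝ) :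
    P.gen (c • f) = c • P.gen f := by
  ext x
  exact gen_eq_of_hasDerivWithinAt (((h.hasDerivWithinAt_gen hf x).const_mul c).congr
    (fun t _ => op_const_mul c f t x) (op_const_mul c f 0 x))

lemma carreDuChamp_add_left (h : P.IsDiffusion A) {f g k : E → ℝ} (hf : f ∈ A) (hg : g ∈ A)
    (hk : k ∈ A) : P.carreDuChamp (f + g) k = P.carreDuChamp f k + P.carreDuChamp g k := by
  ext x
  have hL := congrFun (h.gen_add (A.mul_mem hf hk) (A.mul_mem hg hk)) x
  rw [← add_mul] at hL
  simp only [gen_mul, h.gen_add hf hg, Pi.add_apply, Pi.mul_apply, Pi.smul_apply,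
    smul_eq_mul] at hL ⊢
  linarith

lemma carreDuChamp_smul_left (h : P.IsDiffusion A) {f k : E → ℝ} (hf : f ∈ A) (hk : k ∈ A)
    (c : ℝ) : P.carreDuChamp (c • f) k = c • P.carreDuChamp f k := by
  ext x
  have hL := congrFun (h.gen_smul (A.mul_mem hf hk) c) x
  rw [← smul_mul_assoc] at hL
  simp only [gen_mul, h.gen_smul hf, Pi.add_apply, Pi.mul_apply, Pi.smul_apply, smul_eq_mul]
    at hL ⊢
  linarith

lemma carreDuChamp_add_right (h : P.IsDiffusion A) {f g k : E → ℝ} (hf : f ∈ A) (hg : g ∈ A)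
    (hk : k ∈ A) : P.carreDuChamp k (f + g) = P.carreDuChamp k f + P.carreDuChamp k g := by
  simp only [carreDuChamp_comm k, h.carreDuChamp_add_left hf hg hk]

lemma carreDuChamp_smul_right (h : P.IsDiffusion A) {f k : E → ℝ} (hf : f ∈ A) (hk : k ∈ A)
    (c : ℝ) : P.carreDuChamp k (c • f) = c • P.carreDuChamp k f := by
  simp only [carreDuChamp_comm k, h.carreDuChamp_smul_left hf hk]

lemma carreDuChamp_smul_self (h : P.IsDiffusion A) {f : E → ℝ} (hf : f ∈ A) (c : ℝ) :
    P.carreDuChamp (c • f) (c • f) = (c ^ 2) • P.carreDuChamp f f := by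
  rw [h.carreDuChamp_smul_left hf (A.smul_mem hf c), h.carreDuChamp_smul_right hf hf, smul_smul, sq]

lemma carreDuChamp_add_smul_self (h : P.IsDiffusion A) {f g : E → ℝ} (hf : f ∈ A) (hg : g ∈ A)
    (c : ℝ) : P.carreDuChamp (f + c • g) (f + c • g)
      = P.carreDuChamp f f + (2 * c) • P.carreDuChamp f g + (c ^ 2) • P.carreDuChamp g g := by
  have hcg := A.smul_mem hg c
  rw [h.carreDuChamp_add_left hf hcg (A.add_mem hf hcg), h.carreDuChamp_add_right hf hcg hf,
    h.carreDuChamp_add_right hf hcg hcg, h.carreDuChamp_smul_self hg,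
    carreDuChamp_comm (c • g) f, h.carreDuChamp_smul_right hg hf]
  module

lemma carreDuChamp_const_left (h : P.IsDiffusion A) {g : E → ℝ} (hg : g ∈ A) (c : ℝ) :
    P.carreDuChamp (fun _ => c) g = 0 := by
  ext x
  have hL := congrFun (gen_mul (P := P) (fun _ => c) g) x
  rw [show (fun _ => c) * g = c • g from rfl, h.gen_smul hg, gen_const] at hL
  simpa using hL

lemma carreDuChamp_add_const_self (h : P.IsDiffusion A) {f : E → ℝ} (hf : f ∈ A) (c : ℝ) :
    P.carreDuChamp (f + fun _ => c) (f + fun _ => c) = P.carreDuChamp f f := by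
  have hc := const_mem A c
  rw [h.carreDuChamp_add_left hf hc (A.add_mem hf hc), h.carreDuChamp_const_left (A.add_mem hf hc),
    h.carreDuChamp_add_right hf hc hf, carreDuChamp_comm f (fun _ => c),
    h.carreDuChamp_const_left hf, add_zero, add_zero]

lemma op_sq_le (h : P.IsDiffusion A) {f : E → ℝ} (hf : f ∈ A) {t : ℝ} (ht : 0 ≤ t) (x : E) :
    P.op t f x ^ 2 ≤ P.op t (f ^ 2) x := by
  have := P.isMarkov t ht
  obtain ⟨C, hC⟩ := h.bounded f hf
  have hLp : MemLp f 2 (P.kernel t x) :=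
    .of_bound (h.measurable f hf).aestronglyMeasurable C (ae_of_all _ hC)
  simpa [variance_eq_sub hLp, op] using variance_nonneg f (P.kernel t x)

/-- `2Γ(f)` is the derivative at time `0` of the variance `P_t(f²) - (P_t f)²`. -/
lemma carreDuChamp_self_nonneg (h : P.IsDiffusion A) {f : E → ℝ} (hf : f ∈ A) (x : E) :
    0 ≤ P.carreDuChamp f f x := by
  have hderiv := ((h.hasDerivWithinAt_gen hf x).pow 2).sub
    (h.hasDerivWithinAt_gen (A.pow_mem hf 2) x)
  have hmax : IsLocalMaxOn (fun t => P.op t f x ^ 2 - P.op t (f ^ 2) x) (Ici 0) 0 := by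
    filter_upwards [self_mem_nhdsWithin] with t ht
    rw [op_zero (h.measurable f hf), op_zero (h.measurable _ (A.pow_mem hf 2)), Pi.pow_apply,
      sub_self]
    exact sub_nonpos.2 (h.op_sq_le hf ht x)
  have hle := deriv_nonpos_of_isLocalMaxOn (mem_closure_Ioi_inter_Ici 0) hderiv hmax
  rw [sq f, gen_mul, op_zero (h.measurable f hf)] at hle
  simp only [Pi.add_apply, Pi.mul_apply, Pi.smul_apply, smul_eq_mul, Nat.cast_ofNat,
    Nat.add_one_sub_one, pow_one] at hle
  linarith

lemma carreDuChamp_eq_zero_of_self_eq_zero (h : P.IsDiffusion A) {f g : E → ℝ} (hf : f ∈ A)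
    (hg : g ∈ A) {x : E} (h0 : P.carreDuChamp f f x = 0) : P.carreDuChamp f g x = 0 := by
  have hquad : ∀ s : ℝ, 0 ≤ P.carreDuChamp g g x + 2 * s * P.carreDuChamp f g x := fun s => by
    have hnonneg := h.carreDuChamp_self_nonneg (A.add_mem hg (A.smul_mem hf s)) x
    rw [h.carreDuChamp_add_smul_self hg hf, carreDuChamp_comm g f] at hnonneg
    simpa only [Pi.add_apply, Pi.smul_apply, smul_eq_mul, h0, mul_zero, add_zero] using hnonneg
  by_contra hne
  have := hquad (-(P.carreDuChamp g g x + 1) / (2 * P.carreDuChamp f g x))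
  field_simp at this
  linarith

lemma carreDuChamp_comp_self (h : P.IsDiffusion A) {φ : ℝ → ℝ} (hφ : ContDiff ℝ ∞ φ) {f : E → ℝ}
    (hf : f ∈ A) (x : E) : P.carreDuChamp (fun y => φ (f y)) (fun y => φ (f y)) x
      = deriv φ (f x) ^ 2 * P.carreDuChamp f f x := by
  have hdφ : ∀ z, HasDerivAt φ (deriv φ z) z :=
    fun z => (hφ.differentiable (by simp) z).hasDerivAt
  have hdφ' : HasDerivAt (deriv φ) (deriv (deriv φ) (f x)) (f x) :=
    ((hφ.deriv' (n := ∞)).differentiable (by simp) (f x)).hasDerivAt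
  have hsq' : deriv (fun z => φ z * φ z) = fun z => deriv φ z * φ z + φ z * deriv φ z :=
    funext fun z => ((hdφ z).fun_mul (hdφ z)).deriv
  have hsq'' := ((hdφ'.fun_mul (hdφ (f x))).fun_add ((hdφ (f x)).fun_mul hdφ')).deriv
  have hL := h.chain_rule _ (hφ.mul hφ) f hf x
  rw [hsq', hsq''] at hL
  rw [carreDuChamp, hL, h.chain_rule φ hφ f hf x]
  ring

/-- The function `φ - φ'(f x) • id` of `f` has zero carré du champ at `x`, hence is orthogonal to
every `g` there. -/
lemma carreDuChamp_comp (h : P.IsDiffusion A) {φ : ℝ → ℝ} (hφ : ContDiff ℝ ∞ φ) {f g : E → ℝ}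
    (hf : f ∈ A) (hg : g ∈ A) (x : E) :
    P.carreDuChamp (fun y => φ (f y)) g x = deriv φ (f x) * P.carreDuChamp f g x := by
  set c := deriv φ (f x)
  set ψ : ℝ → ℝ := fun z => φ z + -c * z
  have hψ : ContDiff ℝ ∞ ψ := hφ.add (contDiff_const.mul contDiff_id)
  have hψ' : deriv ψ (f x) = 0 := by
    have := ((hφ.differentiable (by simp) (f x)).hasDerivAt.add
      ((hasDerivAt_id' (f x)).const_mul (-c))).deriv
    rwa [mul_one, add_neg_cancel] at this
  have hψf : (fun y => ψ (f y)) = (fun y => φ (f y)) + (-c) • f := by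
    ext y
    simp [ψ]
  have h0 : P.carreDuChamp (fun y => ψ (f y)) g x = 0 :=
    h.carreDuChamp_eq_zero_of_self_eq_zero (h.comp_mem ψ hψ f hf) hg (by
      rw [h.carreDuChamp_comp_self hψ hf, hψ', zero_pow two_ne_zero, zero_mul])
  rw [hψf, h.carreDuChamp_add_left (h.comp_mem φ hφ f hf) (A.smul_mem hf _) hg,
    h.carreDuChamp_smul_left hf hg] at h0
  simp only [Pi.add_apply, Pi.smul_apply, smul_eq_mul] at h0
  linarith

lemma carreDuChamp_mul_left (h : P.IsDiffusion A) {f g k : E → ℝ} (hf : f ∈ A) (hg : g ∈ A)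
    (hk : k ∈ A) :
    P.carreDuChamp (f * g) k = f * P.carreDuChamp g k + g * P.carreDuChamp f k := by
  have hsq : ∀ f ∈ A, ∀ x, P.carreDuChamp (f * f) k x = 2 * f x * P.carreDuChamp f k x :=
    fun f hf x => by
      have hd : deriv (fun z : ℝ => z * z) (f x) = 2 * f x := by
        rw [((hasDerivAt_id' (f x)).fun_mul (hasDerivAt_id' (f x))).deriv]
        ring
      exact hd ▸ h.carreDuChamp_comp (contDiff_id.mul contDiff_id) hf hk x
  ext x
  have hpolar := hsq (f + g) (A.add_mem hf hg) x
  rw [show (f + g) * (f + g) = f * f + (g * g + (2 : ℝ) • (f * g)) by ext; simp; ring,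
    h.carreDuChamp_add_left (A.mul_mem hf hf) (A.add_mem (A.mul_mem hg hg)
      (A.smul_mem (A.mul_mem hf hg) _)) hk,
    h.carreDuChamp_add_left (A.mul_mem hg hg) (A.smul_mem (A.mul_mem hf hg) _) hk,
    h.carreDuChamp_smul_left (A.mul_mem hf hg) hk, h.carreDuChamp_add_left hf hg hk] at hpolar
  simp only [Pi.add_apply, Pi.smul_apply, smul_eq_mul, Pi.mul_apply, hsq f hf, hsq g hg]
    at hpolar ⊢
  linarith

lemma carreDuChamp_exp_left (h : P.IsDiffusion A) {w g : E → ℝ} (hw : w ∈ A) (hg : g ∈ A) :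
    P.carreDuChamp (fun y => Real.exp (w y)) g
      = (fun y => Real.exp (w y)) * P.carreDuChamp w g := by
  ext x
  rw [h.carreDuChamp_comp Real.contDiff_exp hw hg x, Real.deriv_exp, Pi.mul_apply]

lemma exp_comp_mem (h : P.IsDiffusion A) {w : E → ℝ} (hw : w ∈ A) :
    (fun y => Real.exp (w y)) ∈ A :=
  h.comp_mem _ Real.contDiff_exp w hw

lemma gen_exp_comp (h : P.IsDiffusion A) {w : E → ℝ} (hw : w ∈ A) :
    P.gen (fun y => Real.exp (w y))
      = (fun y => Real.exp (w y)) * (P.gen w + P.carreDuChamp w w) := by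
  ext x
  simpa using h.gen_exp hw 1 0 x

/-- `e^w Γ(w)` is what `L(Φ(e^w)) - Φ'(e^w) L e^w` amounts to for `Φ(z) = z log z`. -/
lemma gen_mul_exp (h : P.IsDiffusion A) {w : E → ℝ} (hw : w ∈ A) :
    P.gen (w * fun y => Real.exp (w y)) = (w + 1) * P.gen (fun y => Real.exp (w y))
      + (fun y => Real.exp (w y)) * P.carreDuChamp w w := by
  rw [gen_mul, carreDuChamp_comm, h.carreDuChamp_exp_left hw hw, h.gen_exp_comp hw]
  ext x
  simp only [Pi.add_apply, Pi.mul_apply, Pi.smul_apply, smul_eq_mul, Pi.one_apply]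
  ring

lemma gen_add_one_mul (h : P.IsDiffusion A) {w g : E → ℝ} (hw : w ∈ A) (hg : g ∈ A) :
    P.gen ((w + 1) * g) = (w + 1) * P.gen g + g * P.gen w + (2 : ℝ) • P.carreDuChamp w g := by
  have h1 : (1 : E → ℝ) = fun _ => 1 := rfl
  rw [gen_mul, h.gen_add hw A.one_mem, h.carreDuChamp_add_left hw A.one_mem hg, h1, gen_const,
    h.carreDuChamp_const_left hg, add_zero, add_zero]

lemma carreDuChamp_gen_exp (h : P.IsDiffusion A) {w : E → ℝ} (hw : w ∈ A) :
    P.carreDuChamp w (P.gen fun y => Real.exp (w y)) = (fun y => Real.exp (w y))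
      * (P.carreDuChamp w (P.gen w) + P.carreDuChamp w (P.carreDuChamp w w)
        + (P.gen w + P.carreDuChamp w w) * P.carreDuChamp w w) := by
  have hL := h.gen_mem w hw
  have hΓ := h.carreDuChamp_mem hw hw
  rw [h.gen_exp_comp hw, carreDuChamp_comm,
    h.carreDuChamp_mul_left (h.exp_comp_mem hw) (A.add_mem hL hΓ) hw,
    h.carreDuChamp_add_left hL hΓ hw, h.carreDuChamp_exp_left hw hw, carreDuChamp_comm (P.gen w),
    carreDuChamp_comm (P.carreDuChamp w w)]
  ring

lemma gen_exp_mul_carreDuChamp (h : P.IsDiffusion A) {w : E → ℝ} (hw : w ∈ A) (x : E) :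
    P.gen ((fun y => Real.exp (w y)) * P.carreDuChamp w w) x
      = 2 * Real.exp (w x) * P.gammaTwo w x
        + P.gen ((w + 1) * P.gen fun y => Real.exp (w y)) x
        - (w x + 1) * P.gen (P.gen fun y => Real.exp (w y)) x
        - P.gen (fun y => Real.exp (w y)) x ^ 2 / Real.exp (w x) := by
  rw [gen_mul, h.carreDuChamp_exp_left hw (h.carreDuChamp_mem hw hw),
    h.gen_add_one_mul hw (h.gen_mem _ (h.exp_comp_mem hw)), h.carreDuChamp_gen_exp hw]
  simp only [h.gen_exp_comp hw, gammaTwo, Pi.add_apply, Pi.mul_apply, Pi.smul_apply, smul_eq_mul,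
    Pi.one_apply]
  field_simp
  ring

end IsDiffusion

end MarkovSemigroup

namespace MarkovSemigroup

variable {E : Type*} [MeasurableSpace E] {P : MarkovSemigroup E} {A : Subalgebra ℝ (E → ℝ)}

lemma isBigO_op {S : Set ℝ} {τ g : ℝ → ℝ} {R : ℝ → E → ℝ} (hτ : ∀ s ∈ S, 0 ≤ τ s)
    (hR : (fun p : ℝ × E => R p.1 p.2) =O[𝓟 (S ×ˢ univ)] fun p => g p.1) (x : E) :
    (fun s => P.op (τ s) (R s) x) =O[𝓟 S] g := by
  obtain ⟨C, hC⟩ := isBigO_principal.1 hR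
  exact isBigO_principal.2
    ⟨C, fun s hs => abs_op_le (hτ s hs) (fun y => hC (s, y) ⟨hs, mem_univ y⟩) x⟩

namespace IsDiffusion

lemma isBigO_one (h : P.IsDiffusion A) {f : E → ℝ} (hf : f ∈ A) {α : Type*} (l : Filter α)
    (π : α → E) : (fun p => f (π p)) =O[l] fun _ => (1 : ℝ) := by
  obtain ⟨C, hC⟩ := h.bounded f hf
  exact .of_bound C (.of_forall fun p => by simpa using hC (π p))

section Taylor

variable {f : E → ℝ} {r : ℝ}

lemma hasDerivWithinAt_op_of_mem (h : P.IsDiffusion A) (hf : f ∈ A) (x : E) :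
    ∀ t ∈ Ici (0 : ℝ), HasDerivWithinAt (fun s => P.op s f x) (P.op t (P.gen f) x) (Ici 0) t :=
  fun _ ht => h.hasDerivWithinAt_op hf ht x

lemma isBigO_op_sub (h : P.IsDiffusion A) (hf : f ∈ A) (hr : 0 ≤ r) :
    (fun p : ℝ × E => P.op p.1 f p.2 - P.op r f p.2)
      =O[𝓟 (Ici 0 ×ˢ univ)] fun p => p.1 - r := by
  obtain ⟨C, hC⟩ := h.lipschitz hf
  exact isBigO_principal.2 ⟨C, fun p hp => hC p.1 r hp.1 hr p.2⟩

lemma isBigO_op_taylor_one (h : P.IsDiffusion A) (hf : f ∈ A) (hr : 0 ≤ r) :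
    (fun p : ℝ × E => P.op p.1 f p.2 - P.op r f p.2 - (p.1 - r) * P.op r (P.gen f) p.2)
      =O[𝓟 (Ici 0 ×ˢ univ)] fun p => (p.1 - r) ^ 2 := by
  obtain ⟨C, hC⟩ := h.lipschitz (h.gen_mem f hf)
  refine isBigO_principal.2 ⟨C, fun p hp => ?_⟩
  rw [norm_pow]
  exact abs_taylor_one_le_of_lipschitz (convex_Ici 0) (h.hasDerivWithinAt_op_of_mem hf p.2)
    (fun s hs t ht => hC s t hs ht p.2) hr hp.1

lemma isBigO_op_taylor_two (h : P.IsDiffusion A) (hf : f ∈ A) (hr : 0 ≤ r) :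
    (fun p : ℝ × E => P.op p.1 f p.2 - P.op r f p.2 - (p.1 - r) * P.op r (P.gen f) p.2
      - (p.1 - r) ^ 2 / 2 * P.op r (P.gen (P.gen f)) p.2)
      =O[𝓟 (Ici 0 ×ˢ univ)] fun p => (p.1 - r) ^ 3 := by
  have hLf := h.gen_mem f hf
  obtain ⟨C, hC⟩ := h.lipschitz (h.gen_mem _ hLf)
  refine isBigO_principal.2 ⟨C, fun p hp => ?_⟩
  rw [norm_pow]
  exact abs_taylor_two_le_of_lipschitz (convex_Ici 0) (h.hasDerivWithinAt_op_of_mem hf p.2)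
    (h.hasDerivWithinAt_op_of_mem hLf p.2) (fun s hs t ht => hC s t hs ht p.2) hr hp.1

end Taylor

lemma op_sub_sub_smul_sub_smul (h : P.IsDiffusion A) {f g K₁ K₂ : E → ℝ} (hf : f ∈ A) (hg : g ∈ A)
    (hK₁ : K₁ ∈ A) (hK₂ : K₂ ∈ A) {t : ℝ} (ht : 0 ≤ t) (a b : ℝ) (x : E) :
    P.op t (f - g - a • K₁ - b • K₂) x
      = P.op t f x - P.op t g x - a * P.op t K₁ x - b * P.op t K₂ x := by
  have hfg := A.sub_mem hf hg
  have hK₁' := A.smul_mem hK₁ a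
  rw [h.op_sub (A.sub_mem hfg hK₁') (A.smul_mem hK₂ b) ht, h.op_sub hfg hK₁' ht,
    h.op_sub hf hg ht, op_smul, op_smul]

lemma hasTaylorTwoWithinAt_op_sub (h : P.IsDiffusion A) {u r : ℝ} {Y : ℝ → E → ℝ} {K₁ K₂ : E → ℝ}
    (hY : ∀ s ∈ Icc 0 u, Y s ∈ A) (hK₁ : K₁ ∈ A) (hK₂ : K₂ ∈ A) (hr : r ∈ Icc 0 u)
    (hexp : (fun p : ℝ × E => Y p.1 p.2 - Y r p.2 - (p.1 - r) * K₁ p.2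
      - (p.1 - r) ^ 2 / 2 * K₂ p.2) =O[𝓟 (Icc 0 u ×ˢ univ)] fun p => (p.1 - r) ^ 3) (x : E) :
    HasTaylorTwoWithinAt (fun s => P.op (u - s) (Y s) x) (P.op (u - r) (K₁ - P.gen (Y r)) x)
      (P.op (u - r) (K₂ - (2 : ℝ) • P.gen K₁ + P.gen (P.gen (Y r))) x) (Icc 0 u) r := by
  have hτ : ∀ s ∈ Icc 0 u, 0 ≤ u - s := fun s hs => sub_nonneg.2 hs.2
  have htendsto : Tendsto (fun s => (u - s, x)) (𝓟 (Icc 0 u)) (𝓟 (Ici 0 ×ˢ univ)) :=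
    tendsto_principal_principal.2 fun s hs => ⟨hτ s hs, mem_univ x⟩
  have hR : (fun s => P.op (u - s) (Y s - Y r - (s - r) • K₁ - ((s - r) ^ 2 / 2) • K₂) x)
      =O[𝓟 (Icc 0 u)] fun s => (s - r) ^ 3 := isBigO_op hτ hexp x
  have hYr := (h.isBigO_op_taylor_two (hY r hr) (hτ r hr)).comp_tendsto htendsto
  have hK₁r := (h.isBigO_op_taylor_one hK₁ (hτ r hr)).comp_tendsto htendsto
  have hK₂r := (h.isBigO_op_sub hK₂ (hτ r hr)).comp_tendsto htendsto
  simp only [Function.comp_def, sub_sub_sub_cancel_left] at hYr hK₁r hK₂r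
  have hδ (n : ℕ) := isBigO_refl (fun s : ℝ => (s - r) ^ n) (𝓟 (Icc 0 u))
  have hrev (n : ℕ) : (fun s => (r - s) ^ n) =O[𝓟 (Icc 0 u)] fun s => (s - r) ^ n :=
    ((hδ n).const_mul_left ((-1) ^ n)).congr_left fun s => by rw [← mul_pow]; ring
  have hK₁r' := ((hδ 1).mul (hK₁r.trans (hrev 2))).congr_right (g₂ := fun s => (s - r) ^ 3)
    fun s => by ring
  have hK₂r' := (((hδ 2).const_mul_left (1 / 2)).mul
    (hK₂r.trans (by simpa using hrev 1))).congr_right (g₂ := fun s => (s - r) ^ 3) fun s => by ring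
  refine .of_isBigO ((((hR.add (hYr.trans (hrev 3))).add hK₁r').add hK₂r').congr' ?_ .rfl)
  filter_upwards [mem_principal_self _] with s hs
  have hLK₁ := A.smul_mem (h.gen_mem _ hK₁) (2 : ℝ)
  have hLY := h.gen_mem _ (hY r hr)
  rw [h.op_sub_sub_smul_sub_smul (hY s hs) (hY r hr) hK₁ hK₂ (hτ s hs),
    h.op_sub hK₁ hLY (hτ r hr), h.op_add_fun (A.sub_mem hK₂ hLK₁) (h.gen_mem _ hLY) (hτ r hr),
    h.op_sub hK₂ hLK₁ (hτ r hr), op_smul]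
  ring

end IsDiffusion

end MarkovSemigroup

lemma exists_contDiff_eqOn_mul_log {m : ℝ} (hm : 0 < m) :
    ∃ Φ : ℝ → ℝ, ContDiff ℝ ∞ Φ ∧ EqOn Φ (fun z => z * Real.log z) (Ioi m) ∧
      EqOn (deriv Φ) (fun z => Real.log z + 1) (Ioi m) ∧
      EqOn (deriv (deriv Φ)) (fun z => z⁻¹) (Ioi m) := by
  obtain ⟨φ, hφ, hlog⟩ := exists_contDiff_eqOn_log hm
  have h₀ : EqOn (fun z => z * φ z) (fun z => z * Real.log z) (Ioi m) :=
    fun z hz => congrArg (z * ·) (hlog hz)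
  have h₁ := h₀.deriv isOpen_Ioi
  refine ⟨_, contDiff_id.mul hφ, h₀, fun z hz => ?_, fun z hz => ?_⟩
  · exact (h₁ hz).trans (Real.deriv_mul_log (hm.trans hz).ne')
  · exact (h₁.deriv isOpen_Ioi hz).trans (Real.deriv2_mul_log z)

namespace MarkovSemigroup

variable {E : Type*} [MeasurableSpace E] {P : MarkovSemigroup E} {A : Subalgebra ℝ (E → ℝ)}

namespace IsDiffusion

lemma le_op (h : P.IsDiffusion A) {f : E → ℝ} (hf : f ∈ A) {c t : ℝ} (ht : 0 ≤ t)
    (hc : ∀ x, c ≤ f x) (x : E) : c ≤ P.op t f x :=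
  (op_const ht c x).symm.le.trans (op_mono h (const_mem A c) hf ht hc x)

lemma exists_pos_le_exp (h : P.IsDiffusion A) {f : E → ℝ} (hf : f ∈ A) :
    ∃ m > 0, ∀ x, m ≤ Real.exp (f x) := by
  obtain ⟨C, hC⟩ := h.bounded f hf
  exact ⟨Real.exp (-C), Real.exp_pos _, fun x => Real.exp_le_exp.2 (neg_le_of_abs_le (hC x))⟩

lemma op_exp_pos (h : P.IsDiffusion A) {f : E → ℝ} (hf : f ∈ A) {t : ℝ} (ht : 0 ≤ t) (x : E) :
    0 < P.op t (fun y => Real.exp (f y)) x := by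
  obtain ⟨m, hm, hle⟩ := h.exists_pos_le_exp hf
  exact hm.trans_le (h.le_op (h.exp_comp_mem hf) ht hle x)

lemma log_mem (h : P.IsDiffusion A) {f : E → ℝ} (hf : f ∈ A) {m : ℝ} (hm : 0 < m)
    (hmf : ∀ x, m < f x) : (fun x => Real.log (f x)) ∈ A := by
  obtain ⟨φ, hφ, hlog⟩ := exists_contDiff_eqOn_log hm
  have hmem := h.comp_mem φ hφ f hf
  rwa [show (fun x => φ (f x)) = fun x => Real.log (f x) from funext fun x => hlog (hmf x)] at hmem

lemma log_op_exp_mem (h : P.IsDiffusion A) {f : E → ℝ} (hf : f ∈ A) {t : ℝ} (ht : 0 ≤ t) :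
    (fun x => Real.log (P.op t (fun y => Real.exp (f y)) x)) ∈ A := by
  obtain ⟨m, hm, hle⟩ := h.exists_pos_le_exp hf
  have hef := h.exp_comp_mem hf
  exact h.log_mem (h.op_mem t ht _ hef) (half_pos hm)
    fun x => (half_lt_self hm).trans_le (h.le_op hef ht hle x)

lemma gammaTwo_mem (h : P.IsDiffusion A) {f : E → ℝ} (hf : f ∈ A) : P.gammaTwo f ∈ A := by
  have hΓ := A.smul_mem (A.sub_mem (h.gen_mem _ (h.carreDuChamp_mem hf hf))
    (A.smul_mem (h.carreDuChamp_mem hf (h.gen_mem f hf)) (2 : ℝ))) (1 / 2 : ℝ)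
  convert hΓ using 1
  ext x
  simp only [gammaTwo, Pi.smul_apply, Pi.sub_apply, smul_eq_mul]
  ring

lemma gen_op (h : P.IsDiffusion A) {f : E → ℝ} (hf : f ∈ A) {t : ℝ} (ht : 0 ≤ t) :
    P.gen (P.op t f) = P.op t (P.gen f) := by
  ext x
  have hshift := (h.hasDerivWithinAt_op hf (t := 0 + t) (by simpa) x).scomp (0 : ℝ)
    ((hasDerivAt_id' (0 : ℝ)).add_const t).hasDerivWithinAt
    (fun s (hs : 0 ≤ s) => add_nonneg hs ht)
  rw [one_smul, zero_add] at hshift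
  exact gen_eq_of_hasDerivWithinAt (hshift.congr (fun s hs => (h.op_add hf hs ht x).symm)
    (h.op_add hf le_rfl ht x).symm)

lemma isBigO_op_one (h : P.IsDiffusion A) {f : E → ℝ} (hf : f ∈ A) :
    (fun p : ℝ × E => P.op p.1 f p.2) =O[𝓟 (Ici 0 ×ˢ univ)] fun _ => (1 : ℝ) := by
  obtain ⟨C, hC⟩ := h.bounded f hf
  exact isBigO_principal.2 ⟨C, fun p hp => by simpa using abs_op_le hp.1 hC p.2⟩

lemma isBigO_comp_op_taylor_two (h : P.IsDiffusion A) {φ : ℝ → ℝ} (hφ : ContDiff ℝ ∞ φ)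
    {g : E → ℝ} (hg : g ∈ A) {r : ℝ} (hr : 0 ≤ r) :
    (fun p : ℝ × E => φ (P.op p.1 g p.2) - φ (P.op r g p.2)
      - (p.1 - r) * (deriv φ (P.op r g p.2) * P.gen (P.op r g) p.2)
      - (p.1 - r) ^ 2 / 2 * (deriv (deriv φ) (P.op r g p.2) * P.gen (P.op r g) p.2 ^ 2
        + deriv φ (P.op r g p.2) * P.gen (P.gen (P.op r g)) p.2))
      =O[𝓟 (Ici 0 ×ˢ univ)] fun p => (p.1 - r) ^ 3 := by
  have hLg := h.gen_mem g hg
  have hk := h.isBigO_one (h.op_mem r hr g hg) (𝓟 (Ici (0 : ℝ) ×ˢ univ)) Prod.snd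
  have hLk := h.isBigO_one (h.op_mem r hr _ hLg) (𝓟 (Ici (0 : ℝ) ×ˢ univ)) Prod.snd
  have hφ' := isBigO_one_comp (hφ.continuous_deriv (by simp)) hk
  have hφ'' := isBigO_one_comp ((hφ.deriv' (n := ∞)).continuous_deriv (by simp)) hk
  have hδ := isBigO_refl (fun p : ℝ × E => p.1 - r) (𝓟 (Ici 0 ×ˢ univ))
  have h₀ := h.isBigO_op_sub hg hr
  have htaylor := (isBigO_comp_taylor_two (contDiff_infty.1 hφ 3) hk (h.isBigO_op_one hg)).trans
    (h₀.pow 3)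
  have hlin := (hφ'.mul (h.isBigO_op_taylor_two hg hr)).congr_right fun p => one_mul _
  have hsq := ((hφ''.const_mul_left (1 / 2)).mul ((h.isBigO_op_taylor_one hg hr).mul
    (h₀.add (hδ.mul hLk |>.congr_right fun p => mul_one _)))).congr_right
      (g₂ := fun p => (p.1 - r) ^ 3) fun p => by ring
  rw [h.gen_op hg hr, h.gen_op hLg hr]
  exact ((htaylor.add hlin).add hsq).congr_left fun p => by ring

end IsDiffusion

end MarkovSemigroup

namespace MarkovSemigroup

variable {E : Type*} [MeasurableSpace E] {P : MarkovSemigroup E} {A : Subalgebra ℝ (E → ℝ)}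

/-- The local logarithmic Sobolev inequality at time `u` with constant `c`, written for the
function `e^f` rather than for its square root: `Ent_{P_u}(e^f) ≤ c P_u(e^f Γ(f))`. -/
def LocalLogSobolev (P : MarkovSemigroup E) (A : Subalgebra ℝ (E → ℝ)) (u c : ℝ) : Prop :=
  ∀ f ∈ A, ∀ x, P.op u (fun y => f y * Real.exp (f y)) x
    - P.op u (fun y => Real.exp (f y)) x * Real.log (P.op u (fun y => Real.exp (f y)) x)
      ≤ c * P.op u (fun y => Real.exp (f y) * P.carreDuChamp f f y) x

namespace IsDiffusion

lemma hasTaylorTwoWithinAt_op_comp_op (h : P.IsDiffusion A) {Φ : ℝ → ℝ} (hΦ : ContDiff ℝ ∞ Φ)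
    {g k : E → ℝ} (hg : g ∈ A) {u r : ℝ} (hr : r ∈ Icc 0 u) (hk : P.op r g = k) (x : E) :
    HasTaylorTwoWithinAt (fun s => P.op (u - s) (fun y => Φ (P.op s g y)) x)
      (P.op (u - r) ((fun y => deriv Φ (k y) * P.gen k y) - P.gen fun y => Φ (k y)) x)
      (P.op (u - r) ((fun y => deriv (deriv Φ) (k y) * P.gen k y ^ 2
          + deriv Φ (k y) * P.gen (P.gen k) y)
        - (2 : ℝ) • P.gen (fun y => deriv Φ (k y) * P.gen k y)
        + P.gen (P.gen fun y => Φ (k y))) x) (Icc 0 u) r := by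
  subst hk
  have hk := h.op_mem r hr.1 g hg
  have hLk := h.gen_mem _ hk
  have hΦ' : ContDiff ℝ ∞ (deriv Φ) := hΦ.deriv' (n := ∞)
  have hΦk := h.comp_mem _ hΦ' _ hk
  refine h.hasTaylorTwoWithinAt_op_sub (fun s hs => h.comp_mem Φ hΦ _ (h.op_mem s hs.1 g hg))
    (A.mul_mem hΦk hLk) (A.add_mem (A.mul_mem (h.comp_mem _ (hΦ'.deriv' (n := ∞)) _ hk)
      (A.pow_mem hLk 2)) (A.mul_mem hΦk (h.gen_mem _ hLk))) hr ?_ x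
  exact (h.isBigO_comp_op_taylor_two hΦ hg hr.1).mono
    (principal_mono.2 (prod_mono_left fun s hs => hs.1))

lemma hasTaylorTwoWithinAt_op_mul_log (h : P.IsDiffusion A) {g w : E → ℝ} (hg : g ∈ A)
    {m u r : ℝ} (hm : 0 < m) (hmg : ∀ x, m ≤ g x) (hr : r ∈ Icc 0 u) (hw : w ∈ A)
    (hwg : P.op r g = fun y => Real.exp (w y)) (x : E) :
    HasTaylorTwoWithinAt
      (fun s => P.op (u - s) (fun y => P.op s g y * Real.log (P.op s g y)) x)
      (-P.op (u - r) (fun y => Real.exp (w y) * P.carreDuChamp w w y) x)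
      (2 * P.op (u - r) (fun y => Real.exp (w y) * P.gammaTwo w y) x) (Icc 0 u) r := by
  obtain ⟨Φ, hΦ, hΦ₀, hΦ₁, hΦ₂⟩ := exists_contDiff_eqOn_mul_log (half_pos hm)
  have hrange : ∀ s ∈ Icc 0 u, ∀ y, P.op s g y ∈ Ioi (m / 2) := fun s hs y =>
    (half_lt_self hm).trans_le (h.le_op hg hs.1 hmg y)
  have hexp : ∀ y, Real.exp (w y) ∈ Ioi (m / 2) := fun y => congrFun hwg y ▸ hrange r hr y
  have e₀ : (fun y => Φ (Real.exp (w y))) = w * fun y => Real.exp (w y) := by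
    ext y
    simp only [hΦ₀ (hexp y), Real.log_exp, Pi.mul_apply, mul_comm]
  have e₁ : (fun y => deriv Φ (Real.exp (w y)) * P.gen (fun y => Real.exp (w y)) y)
      = (w + 1) * P.gen fun y => Real.exp (w y) := by
    ext y
    simp only [hΦ₁ (hexp y), Real.log_exp, Pi.mul_apply, Pi.add_apply, Pi.one_apply]
  have hk := h.exp_comp_mem hw
  have hΓ := A.mul_mem hk (h.carreDuChamp_mem hw hw)
  have hT := h.hasTaylorTwoWithinAt_op_comp_op hΦ hg hr hwg x
  rw [e₀, e₁, h.gen_mul_exp hw, h.gen_add (A.mul_mem (A.add_mem hw A.one_mem) (h.gen_mem _ hk)) hΓ]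
    at hT
  rw [← neg_one_mul, ← op_smul, ← op_smul]
  convert hT.congr (fun s hs => ?_) hr using 2
  · ext y
    simp
  · ext y
    simp only [Pi.add_apply, Pi.sub_apply, Pi.smul_apply, smul_eq_mul,
      h.gen_exp_mul_carreDuChamp hw, hΦ₁ (hexp y), hΦ₂ (hexp y), Real.log_exp]
    ring
  · simp only [hΦ₀ (hrange s hs _)]

lemma mul_op_exp_mul_carreDuChamp_le (h : P.IsDiffusion A) {ρ : ℝ} (hCD : P.CDInfty A ρ)
    {w : E → ℝ} (hw : w ∈ A) {t : ℝ} (ht : 0 ≤ t) (x : E) :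
    ρ * P.op t (fun y => Real.exp (w y) * P.carreDuChamp w w y) x
      ≤ P.op t (fun y => Real.exp (w y) * P.gammaTwo w y) x := by
  have hΓ := A.mul_mem (h.exp_comp_mem hw) (h.carreDuChamp_mem hw hw)
  have hΓ₂ := A.mul_mem (h.exp_comp_mem hw) (h.gammaTwo_mem hw)
  refine (op_smul ρ _ t x).symm.le.trans (op_mono h (A.smul_mem hΓ ρ) hΓ₂ ht (fun y => ?_) x)
  exact (mul_left_comm _ _ _).trans_le
    (mul_le_mul_of_nonneg_left (hCD w hw y) (Real.exp_pos (w y)).le)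

theorem localLogSobolev_of_CDInfty (h : P.IsDiffusion A) {ρ u : ℝ} (hCD : P.CDInfty A ρ)
    (hu : 0 ≤ u) : P.LocalLogSobolev A u (sobolevConst ρ u) := by
  intro f hf x
  obtain ⟨m, hm, hmf⟩ := h.exists_pos_le_exp hf
  have hef := h.exp_comp_mem hf
  have hw := fun r (hr : r ∈ Icc 0 u) => h.log_op_exp_mem hf hr.1
  have hentropy := add_mul_sobolevConst_le hu (ρ := ρ)
    (fun r hr => h.hasTaylorTwoWithinAt_op_mul_log hef hm hmf hr (hw r hr)
      (funext fun y => (Real.exp_log (h.op_exp_pos hf hr.1 y)).symm) x) fun r hr => by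
    linarith [h.mul_op_exp_mul_carreDuChamp_le hCD (hw r hr) (sub_nonneg.2 hr.2) x]
  simp only [op_zero (h.measurable _ hef), Real.log_exp, sub_zero, sub_self] at hentropy
  rw [op_zero ((h.measurable _ (h.op_mem u hu _ hef)).fun_mul
    (h.measurable _ (h.log_op_exp_mem hf hu)))] at hentropy
  simp only [mul_comm (f _)]
  linarith

end IsDiffusion

end MarkovSemigroup

lemma second_order_of_sub_mul_log_le {F F' G G' N N' c c' : ℝ → ℝ} {F'' G'' c'' : ℝ}
    (hF : ∀ t ∈ Ici 0, HasDerivWithinAt F (F' t) (Ici 0) t)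
    (hF' : HasDerivWithinAt F' F'' (Ici 0) 0)
    (hG : ∀ t ∈ Ici 0, HasDerivWithinAt G (G' t) (Ici 0) t)
    (hG' : HasDerivWithinAt G' G'' (Ici 0) 0)
    (hN : ∀ t ∈ Ici 0, HasDerivWithinAt N (N' t) (Ici 0) t)
    (hN' : DifferentiableWithinAt ℝ N' (Ici 0) 0)
    (hc : ∀ t ∈ Ici 0, HasDerivWithinAt c (c' t) (Ici 0) t)
    (hc' : HasDerivWithinAt c' c'' (Ici 0) 0)
    (hpos : ∀ t ∈ Ici (0 : ℝ), G t ≠ 0) (hle : ∀ t ∈ Ioi 0, F t - G t * Real.log (G t) ≤ c t * N t)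
    (hc₀ : c 0 = 0) (h₀ : F 0 = G 0 * Real.log (G 0))
    (h₁ : F' 0 = (Real.log (G 0) + 1) * G' 0 + c' 0 * N 0) :
    F'' ≤ G' 0 ^ 2 / G 0 + (Real.log (G 0) + 1) * G'' + c'' * N 0 + 2 * c' 0 * N' 0 := by
  have h0 := self_mem_Ici (a := (0 : ℝ))
  have hD : ∀ t ∈ Ici 0, HasDerivWithinAt (fun t => F t - G t * Real.log (G t) - c t * N t)
      (F' t - (Real.log (G t) + 1) * G' t - (c' t * N t + c t * N' t)) (Ici 0) t := fun t ht =>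
    ((hF t ht).fun_sub ((hG t ht).fun_mul ((hG t ht).log (hpos t ht))
      |>.congr_deriv (by field_simp [hpos t ht]))).fun_sub ((hc t ht).fun_mul (hN t ht))
  have hD' := (hF'.fun_sub ((((hG 0 h0).log (hpos 0 h0)).add_const 1).fun_mul hG')).fun_sub
    ((hc'.fun_mul (hN 0 h0)).fun_add ((hc 0 h0).fun_mul hN'.hasDerivWithinAt))
  have hmax : IsLocalMaxOn (fun t => F t - G t * Real.log (G t) - c t * N t) (Ici 0) 0 := by
    filter_upwards [self_mem_nhdsWithin] with t ht
    rcases (mem_Ici.1 ht).eq_or_lt with rfl | ht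
    · rfl
    · simpa [hc₀, h₀] using hle t ht
  have hcrit := second_deriv_nonpos_of_isLocalMaxOn hD (by rw [h₁, hc₀]; ring) hD' hmax
  rw [hc₀] at hcrit
  linear_combination hcrit

namespace MarkovSemigroup

variable {E : Type*} [MeasurableSpace E] {P : MarkovSemigroup E} {A : Subalgebra ℝ (E → ℝ)}

namespace IsDiffusion

theorem CDInfty_of_localLogSobolev (h : P.IsDiffusion A) {ρ : ℝ}
    (hLSI : ∀ u, 0 < u → P.LocalLogSobolev A u (sobolevConst ρ u)) : P.CDInfty A ρ := by
  intro f hf x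
  have hg := h.exp_comp_mem hf
  have hN := A.mul_mem hg (h.carreDuChamp_mem hf hf)
  have hfg := A.mul_mem hf hg
  have hLg := h.gen_mem _ hg
  have hLfg := h.gen_mem _ hfg
  have hLN := h.gen_mem _ hN
  have h0 := self_mem_Ici (a := (0 : ℝ))
  have hop := fun {k : E → ℝ} (hk : k ∈ A) => h.hasDerivWithinAt_op_of_mem hk x
  have hzero := fun {k : E → ℝ} (hk : k ∈ A) => op_zero (P := P) (h.measurable k hk) x
  have hord := second_order_of_sub_mul_log_le (hop hfg) (hop hLfg 0 h0) (hop hg) (hop hLg 0 h0)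
    (hop hN) (hop hLN 0 h0).differentiableWithinAt
    (fun t _ => (hasDerivAt_sobolevConst ρ t).hasDerivWithinAt)
    (hasDerivAt_exp_const_mul (-2 * ρ) 0).hasDerivWithinAt
    (fun t ht => (h.op_exp_pos hf ht x).ne') (fun t ht => hLSI t ht f hf x) (sobolevConst_zero ρ)
    (by rw [hzero hfg, hzero hg, Real.log_exp, Pi.mul_apply, mul_comm])
    (by
      rw [hzero hLfg, hzero hg, hzero hLg, hzero hN, h.gen_mul_exp hf]
      simp)
  rw [hzero hg, hzero hLg, hzero hN, hzero hLN, hzero (h.gen_mem _ hLg),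
    hzero (h.gen_mem _ hLfg), h.gen_mul_exp hf,
    h.gen_add (A.mul_mem (A.add_mem hf A.one_mem) hLg) hN] at hord
  simp only [Pi.add_apply, Pi.mul_apply, h.gen_exp_mul_carreDuChamp hf, Real.log_exp, mul_zero,
    Real.exp_zero] at hord
  refine le_of_mul_le_mul_left ?_ (Real.exp_pos (f x))
  linarith

end IsDiffusion

end MarkovSemigroup

/-- The curve `v` of functions on `E` is bounded on `[0, T]` and has derivative `d` at `r`, relative
to `[0, T]` and in the sup norm. The remainder is required to be quadratic rather than merely
`o(s - r)`; the bound is expressed by `=O` along a principal filter. -/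
structure HasUniformDeriv {E : Type*} (v : ℝ → E → ℝ) (d : E → ℝ) (T r : ℝ) : Prop where
  mem : r ∈ Icc 0 T
  isBigO_one : (fun p : ℝ × E => v p.1 p.2) =O[𝓟 (Icc 0 T ×ˢ univ)] fun _ => (1 : ℝ)
  deriv_isBigO_one : (fun p : ℝ × E => d p.2) =O[𝓟 (Icc 0 T ×ˢ univ)] fun _ => (1 : ℝ)
  taylor : (fun p : ℝ × E => v p.1 p.2 - v r p.2 - (p.1 - r) * d p.2)
    =O[𝓟 (Icc 0 T ×ˢ univ)] fun p => (p.1 - r) ^ 2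

lemma isBigO_one_fst_of_continuous {E : Type*} {q : ℝ → ℝ} (hq : Continuous q) (T : ℝ) :
    (fun p : ℝ × E => q p.1) =O[𝓟 (Icc 0 T ×ˢ univ)] fun _ => (1 : ℝ) := by
  obtain ⟨C, hC⟩ := (isCompact_Icc (a := 0) (b := T)).exists_bound_of_continuousOn hq.continuousOn
  exact isBigO_principal.2 ⟨C, fun p hp => by simpa using hC p.1 hp.1⟩

namespace HasUniformDeriv

variable {E : Type*} {v w : ℝ → E → ℝ} {d e : E → ℝ} {T r : ℝ}

lemma initial_isBigO_one (hv : HasUniformDeriv v d T r) :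
    (fun p : ℝ × E => v r p.2) =O[𝓟 (Icc 0 T ×ˢ univ)] fun _ => (1 : ℝ) :=
  hv.isBigO_one.comp_tendsto (k := fun p : ℝ × E => (r, p.2))
    (tendsto_principal_principal.2 fun (p : ℝ × E) _ => ⟨hv.mem, mem_univ p.2⟩)

lemma sub_isBigO (hv : HasUniformDeriv v d T r) :
    (fun p : ℝ × E => v p.1 p.2 - v r p.2) =O[𝓟 (Icc 0 T ×ˢ univ)] fun p => p.1 - r := by
  have hδ := isBigO_refl (fun p : ℝ × E => p.1 - r) (𝓟 (Icc 0 T ×ˢ univ))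
  have hsq : (fun p : ℝ × E => (p.1 - r) ^ 2) =O[𝓟 (Icc 0 T ×ˢ univ)] fun p => p.1 - r :=
    (hδ.mul (isBigO_one_fst_of_continuous (continuous_sub_right r) T)).congr (fun _ => (sq _).symm)
      fun _ => mul_one _
  have hlin := (hδ.mul hv.deriv_isBigO_one).congr_right fun _ => mul_one _
  exact ((hv.taylor.trans hsq).add hlin).congr_left fun p => by ring

lemma of_quadratic {a b c : E → ℝ} (ha : a =O[⊤] fun _ => (1 : ℝ))
    (hb : b =O[⊤] fun _ => (1 : ℝ)) (hc : c =O[⊤] fun _ => (1 : ℝ)) (hr : r ∈ Icc 0 T) :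
    HasUniformDeriv (fun s y => a y + s * b y + s ^ 2 * c y) (fun y => b y + 2 * r * c y) T r where
  mem := hr
  isBigO_one := ((ha.comp_tendsto tendsto_top).add (isBigO_one_mul
    (isBigO_one_fst_of_continuous continuous_id T) (hb.comp_tendsto tendsto_top))).add
      (isBigO_one_mul (isBigO_one_fst_of_continuous (continuous_pow 2) T)
        (hc.comp_tendsto tendsto_top))
  deriv_isBigO_one := (hb.comp_tendsto tendsto_top).add
    ((hc.comp_tendsto tendsto_top).const_mul_left (2 * r))
  taylor := ((isBigO_refl (fun p : ℝ × E => (p.1 - r) ^ 2) _).mul (hc.comp_tendsto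
    tendsto_top)).congr (fun p => by simp only [Function.comp_apply]; ring) fun p => mul_one _

lemma const_smul (hv : HasUniformDeriv v d T r) (c : ℝ) :
    HasUniformDeriv (fun s => c • v s) (c • d) T r where
  mem := hv.mem
  isBigO_one := hv.isBigO_one.const_mul_left c
  deriv_isBigO_one := hv.deriv_isBigO_one.const_mul_left c
  taylor := (hv.taylor.const_mul_left c).congr_left fun p => by
    simp only [Pi.smul_apply, smul_eq_mul]
    ring

lemma congr (hv : HasUniformDeriv v d T r) (hvw : ∀ s ∈ Icc 0 T, w s = v s) :
    HasUniformDeriv w d T r where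
  mem := hv.mem
  isBigO_one := hv.isBigO_one.congr'
    (eventually_principal.2 fun p hp => by simp only [hvw _ hp.1]) .rfl
  deriv_isBigO_one := hv.deriv_isBigO_one
  taylor := hv.taylor.congr'
    (eventually_principal.2 fun p hp => by simp only [hvw _ hp.1, hvw r hv.mem]) .rfl

lemma mul (hv : HasUniformDeriv v d T r) (hw : HasUniformDeriv w e T r) :
    HasUniformDeriv (fun s y => v s y * w s y) (fun y => d y * w r y + v r y * e y) T r where
  mem := hv.mem
  isBigO_one := isBigO_one_mul hv.isBigO_one hw.isBigO_one
  deriv_isBigO_one := (isBigO_one_mul hv.deriv_isBigO_one hw.initial_isBigO_one).add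
    (isBigO_one_mul hv.initial_isBigO_one hw.deriv_isBigO_one)
  taylor := by
    have hvw := (hv.sub_isBigO.mul hw.sub_isBigO).congr_right fun p => (sq _).symm
    have hv' := (hv.taylor.mul hw.initial_isBigO_one).congr_right fun p => mul_one _
    have hw' := (hv.initial_isBigO_one.mul hw.taylor).congr_right fun p => one_mul _
    exact ((hvw.add hv').add hw').congr_left fun p => by ring

lemma comp {φ : ℝ → ℝ} (hφ : ContDiff ℝ 2 φ) (hv : HasUniformDeriv v d T r) :
    HasUniformDeriv (fun s y => φ (v s y)) (fun y => deriv φ (v r y) * d y) T r where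
  mem := hv.mem
  isBigO_one := isBigO_one_comp hφ.continuous hv.isBigO_one
  deriv_isBigO_one := isBigO_one_mul (isBigO_one_comp (hφ.continuous_deriv (by norm_num))
    hv.initial_isBigO_one) hv.deriv_isBigO_one
  taylor := by
    have hremainder := (isBigO_comp_taylor_one hφ hv.initial_isBigO_one hv.isBigO_one).trans
      (hv.sub_isBigO.pow 2)
    have hlin := ((isBigO_one_comp (hφ.continuous_deriv (by norm_num))
      hv.initial_isBigO_one).mul hv.taylor).congr_right fun p => one_mul _
    exact (hremainder.add hlin).congr_left fun p => by ring

lemma exp (hv : HasUniformDeriv v d T r) :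
    HasUniformDeriv (fun s y => Real.exp (v s y)) (fun y => Real.exp (v r y) * d y) T r := by
  simpa only [Real.deriv_exp] using hv.comp Real.contDiff_exp

lemma eventually_abs_sub_le (hv : HasUniformDeriv v d T r) {η : ℝ} (hη : 0 < η) :
    ∀ᶠ s in 𝓝[Icc 0 T] r, ∀ y, |v s y - v r y - (s - r) * d y| ≤ η * |s - r| := by
  obtain ⟨C, hC⟩ := isBigO_principal.1 hv.taylor
  have hlim : Tendsto (fun s => C * |s - r|) (𝓝[Icc 0 T] r) (𝓝 0) := by
    have hcont : Continuous fun s => C * |s - r| := by fun_prop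
    simpa using (hcont.tendsto r).mono_left nhdsWithin_le_nhds
  filter_upwards [hlim.eventually (gt_mem_nhds hη), self_mem_nhdsWithin] with s hs hsT y
  calc |v s y - v r y - (s - r) * d y| ≤ C * |s - r| * |s - r| := by
        simpa only [Real.norm_eq_abs, sq, mul_assoc, abs_mul] using hC (s, y) ⟨hsT, mem_univ y⟩
    _ ≤ η * |s - r| := by gcongr

end HasUniformDeriv

namespace MarkovSemigroup

variable {E : Type*} [MeasurableSpace E] {P : MarkovSemigroup E} {A : Subalgebra ℝ (E → ℝ)}

namespace IsDiffusion

lemma hasUniformDeriv_op (h : P.IsDiffusion A) {f : E → ℝ} (hf : f ∈ A) {ε T r : ℝ} (hε : 0 ≤ ε)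
    (hr : r ∈ Icc 0 T) :
    HasUniformDeriv (fun s => P.op (ε * s) f) (ε • P.op (ε * r) (P.gen f)) T r := by
  have hεr := mul_nonneg hε hr.1
  have htendsto : Tendsto (fun p : ℝ × E => (ε * p.1, p.2)) (𝓟 (Icc 0 T ×ˢ univ))
      (𝓟 (Ici 0 ×ˢ univ)) :=
    tendsto_principal_principal.2 fun p hp => ⟨mul_nonneg hε hp.1.1, mem_univ p.2⟩
  refine ⟨hr, (h.isBigO_op_one hf).comp_tendsto htendsto, h.isBigO_one
    (A.smul_mem (h.op_mem _ hεr _ (h.gen_mem f hf)) ε) _ Prod.snd, ?_⟩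
  have hsq : (fun p : ℝ × E => (ε * p.1 - ε * r) ^ 2) =O[𝓟 (Icc 0 T ×ˢ univ)]
      fun p => (p.1 - r) ^ 2 :=
    ((isBigO_refl (fun p : ℝ × E => (p.1 - r) ^ 2) _).const_mul_left (ε ^ 2)).congr_left
      fun p => by ring
  refine (((h.isBigO_op_taylor_one hf hεr).comp_tendsto htendsto).trans hsq).congr_left fun p => ?_
  simp only [Function.comp_apply, Pi.smul_apply, smul_eq_mul]
  ring

lemma hasDerivWithinAt_op_exp (h : P.IsDiffusion A) {ε T s : ℝ} (hε : 0 ≤ ε) {w : ℝ → E → ℝ}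
    {d : E → ℝ} (hw : ∀ r ∈ Icc 0 T, w r ∈ A) (hd : d ∈ A) (hwd : HasUniformDeriv w d T s) (x : E) :
    HasDerivWithinAt (fun r => P.op (ε * (T - r)) (fun y => Real.exp (w r y)) x)
      (P.op (ε * (T - s)) ((fun y => Real.exp (w s y))
        * (d - ε • (P.gen (w s) + P.carreDuChamp (w s) (w s)))) x) (Icc 0 T) s := by
  have hws := hw s hwd.mem
  have hexp := h.exp_comp_mem hws
  have hflow := h.hasDerivWithinAt_flow hε (fun r hr => h.exp_comp_mem (hw r hr))
    (A.mul_mem hexp hd) hwd.mem (fun η hη => hwd.exp.eventually_abs_sub_le hη) x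
  rwa [← op_smul, ← h.op_sub (A.mul_mem hexp hd) (A.smul_mem (h.gen_mem _ hexp) ε)
    (mul_nonneg hε (sub_nonneg.2 hwd.mem.2)), h.gen_exp_comp hws, ← mul_smul_comm,
    ← mul_sub] at hflow

lemma hasDerivWithinAt_op_const (h : P.IsDiffusion A) {u T s : ℝ} (hu : 0 ≤ u) {v : ℝ → E → ℝ}
    {d : E → ℝ} (hv : ∀ r ∈ Icc 0 T, v r ∈ A) (hd : d ∈ A) (hvd : HasUniformDeriv v d T s) (x : E) :
    HasDerivWithinAt (fun r => P.op u (v r) x) (P.op u d x) (Icc 0 T) s := by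
  rw [hasDerivWithinAt_iff_isLittleO, isLittleO_iff]
  intro η hη
  filter_upwards [hvd.eventually_abs_sub_le hη, self_mem_nhdsWithin] with r hr hrT
  have hle : |P.op u (v r - v s - (r - s) • d) x| ≤ η * |r - s| := abs_op_le hu hr x
  rwa [h.op_sub (A.sub_mem (hv r hrT) (hv s hvd.mem)) (A.smul_mem hd _) hu,
    h.op_sub (hv r hrT) (hv s hvd.mem) hu, op_smul] at hle

lemma hasUniformDeriv_log_op_exp (h : P.IsDiffusion A) {f w : E → ℝ} (hf : f ∈ A) {ε T r : ℝ}
    (hε : 0 ≤ ε) (hr : r ∈ Icc 0 T)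
    (hw : w = fun y => Real.log (P.op (ε * r) (fun z => Real.exp (f z)) y)) :
    HasUniformDeriv (fun s y => Real.log (P.op (ε * s) (fun z => Real.exp (f z)) y))
      (ε • (P.gen w + P.carreDuChamp w w)) T r := by
  obtain ⟨m, hm, hmf⟩ := h.exists_pos_le_exp hf
  obtain ⟨φ, hφ, hlog⟩ := exists_contDiff_eqOn_log (half_pos hm)
  have hef := h.exp_comp_mem hf
  have hrange : ∀ s ∈ Icc 0 T, ∀ y, P.op (ε * s) (fun z => Real.exp (f z)) y ∈ Ioi (m / 2) :=
    fun s hs y => (half_lt_self hm).trans_le (h.le_op hef (mul_nonneg hε hs.1) hmf y)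
  have hwA : w ∈ A := hw ▸ h.log_op_exp_mem hf (mul_nonneg hε hr.1)
  have hkw : P.op (ε * r) (fun z => Real.exp (f z)) = fun y => Real.exp (w y) := by
    ext y
    rw [hw, Real.exp_log (h.op_exp_pos hf (mul_nonneg hε hr.1) y)]
  have hderiv := ((h.hasUniformDeriv_op hef hε hr).comp (contDiff_infty.1 hφ 2)).congr
    fun s hs => funext fun y => (hlog (hrange s hs y)).symm
  convert hderiv using 1
  ext y
  have hφ' := hlog.deriv isOpen_Ioi (hrange r hr y)
  rw [Real.deriv_log, hkw] at hφ'
  rw [← h.gen_op hef (mul_nonneg hε hr.1), hkw, hφ', h.gen_exp_comp hwA]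
  simp only [Pi.smul_apply, smul_eq_mul, Pi.mul_apply]
  field_simp

end IsDiffusion

end MarkovSemigroup

namespace MarkovSemigroup

variable {E : Type*} [MeasurableSpace E] {P : MarkovSemigroup E} {A : Subalgebra ℝ (E → ℝ)}

lemma viscousHJ_eq_smul_log (ε t : ℝ) (f : E → ℝ) :
    P.viscousHJ ε t f = (-2 * ε) •
      fun x => Real.log (P.op (ε * t) (fun y => Real.exp (((-1 / (2 * ε)) • f) y)) x) := by
  ext x
  simp only [viscousHJ, Pi.smul_apply, smul_eq_mul, neg_div, neg_mul, one_div_mul_eq_div]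

namespace IsDiffusion

lemma viscousHJ_mem (h : P.IsDiffusion A) {f : E → ℝ} (hf : f ∈ A) {ε t : ℝ} (ht : 0 ≤ ε * t) :
    P.viscousHJ ε t f ∈ A := by
  rw [viscousHJ_eq_smul_log]
  exact A.smul_mem (h.log_op_exp_mem (A.smul_mem hf _) ht) _

lemma viscousHJ_zero (h : P.IsDiffusion A) {f : E → ℝ} (hf : f ∈ A) {ε : ℝ} (hε : ε ≠ 0) :
    P.viscousHJ ε 0 f = f := by
  ext x
  have hexp := h.measurable _ (h.exp_comp_mem (A.smul_mem hf (-1 / (2 * ε))))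
  rw [viscousHJ_eq_smul_log, mul_zero, Pi.smul_apply, op_zero hexp, Real.log_exp,
    Pi.smul_apply, smul_smul]
  field_simp
  simp

lemma hasUniformDeriv_viscousHJ (h : P.IsDiffusion A) {f v : E → ℝ} (hf : f ∈ A) {ε T r : ℝ}
    (hε : 0 < ε) (hr : r ∈ Icc 0 T) (hv : P.viscousHJ ε r f = v) :
    HasUniformDeriv (fun s => P.viscousHJ ε s f)
      (ε • P.gen v - (1 / 2 : ℝ) • P.carreDuChamp v v) T r := by
  have hlog := (h.hasUniformDeriv_log_op_exp (A.smul_mem hf (-1 / (2 * ε))) hε.le hr rfl).const_smul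
    (-2 * ε)
  rw [viscousHJ_eq_smul_log] at hv
  have hw := h.log_op_exp_mem (A.smul_mem hf (-1 / (2 * ε))) (mul_nonneg hε.le hr.1)
  simp only [← viscousHJ_eq_smul_log] at hlog
  convert hlog using 1
  rw [← hv, h.gen_smul hw, h.carreDuChamp_smul_self hw]
  module

lemma le_viscousHJ_of_subsolution (h : P.IsDiffusion A) {ε T : ℝ} (hε : 0 < ε) (hT : 0 ≤ T)
    {w d : ℝ → E → ℝ} (hw : ∀ s ∈ Icc 0 T, w s ∈ A) (hd : ∀ s ∈ Icc 0 T, d s ∈ A)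
    (hwd : ∀ s ∈ Icc 0 T, HasUniformDeriv w (d s) T s)
    (hsub : ∀ s ∈ Icc 0 T, ∀ y,
      d s y ≤ ε * P.gen (w s) y - 1 / 2 * P.carreDuChamp (w s) (w s) y) (x : E) :
    w T x ≤ P.viscousHJ ε T (w 0) x := by
  set a := -1 / (2 * ε) with ha
  have ha₀ : a ≤ 0 := div_nonpos_of_nonpos_of_nonneg (by norm_num) (by positivity)
  have haw := fun s hs => A.smul_mem (hw s hs) a
  have hderiv := fun s (hs : s ∈ Icc 0 T) => h.hasDerivWithinAt_op_exp hε.le haw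
    (A.smul_mem (hd s hs) a) ((hwd s hs).const_smul a) x
  have hmono : MonotoneOn (fun s => P.op (ε * (T - s)) (fun y => Real.exp ((a • w s) y)) x)
      (Icc 0 T) := by
    refine monotoneOn_of_hasDerivWithinAt_nonneg (convex_Icc 0 T)
      (fun s hs => (hderiv s hs).continuousWithinAt)
      (fun s hs => (hderiv s (interior_subset hs)).mono interior_subset)
      fun s hs => integral_nonneg fun y => mul_nonneg (Real.exp_pos _).le ?_
    have hs := interior_subset hs
    rw [h.gen_smul (hw s hs), h.carreDuChamp_smul_self (hw s hs)]
    have hnonneg := mul_nonneg_of_nonpos_of_nonpos ha₀ (sub_nonpos.2 (hsub s hs y))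
    simp only [Pi.sub_apply, Pi.smul_apply, Pi.add_apply, smul_eq_mul]
    convert hnonneg using 1
    rw [ha]
    field_simp
    ring
  have hle := hmono ⟨le_rfl, hT⟩ ⟨hT, le_rfl⟩ hT
  simp only [sub_zero, sub_self, mul_zero,
    op_zero (h.measurable _ (h.exp_comp_mem (haw T ⟨hT, le_rfl⟩)))] at hle
  have hlog := (Real.log_le_iff_le_exp
    (h.op_exp_pos (haw 0 ⟨le_rfl, hT⟩) (mul_nonneg hε.le hT) x)).2 hle
  rw [viscousHJ_eq_smul_log]
  have := mul_le_mul_of_nonneg_left hlog (show 0 ≤ 2 * ε by positivity)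
  have haε : 2 * ε * a = -1 := by rw [ha]; field_simp
  simp only [Pi.smul_apply, smul_eq_mul, ← mul_assoc, haε] at this ⊢
  linarith

lemma abs_log_op_exp_le (h : P.IsDiffusion A) {f : E → ℝ} (hf : f ∈ A) {C : ℝ}
    (hC : ∀ x, |f x| ≤ C) {t : ℝ} (ht : 0 ≤ t) (x : E) :
    |Real.log (P.op t (fun y => Real.exp (f y)) x)| ≤ C := by
  have hA := h.exp_comp_mem hf
  have hpos := h.op_exp_pos hf ht x
  refine abs_le.2 ⟨(Real.le_log_iff_exp_le hpos).2 ?_, (Real.log_le_iff_le_exp hpos).2 ?_⟩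
  · exact h.le_op hA ht (fun y => Real.exp_le_exp.2 (abs_le.1 (hC y)).1) x
  · calc P.op t (fun y => Real.exp (f y)) x ≤ P.op t (fun _ => Real.exp C) x :=
          op_mono h hA (const_mem A _) ht (fun y => Real.exp_le_exp.2 (abs_le.1 (hC y)).2) x
      _ = Real.exp C := op_const ht _ x

lemma abs_viscousHJ_le (h : P.IsDiffusion A) {f : E → ℝ} (hf : f ∈ A) {C : ℝ}
    (hC : ∀ x, |f x| ≤ C) {ε t : ℝ} (hε : 0 < ε) (ht : 0 ≤ t) (x : E) :
    |P.viscousHJ ε t f x| ≤ C := by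
  have hbound : ∀ y, |((-1 / (2 * ε)) • f) y| ≤ C / (2 * ε) := fun y => by
    rw [Pi.smul_apply, smul_eq_mul, abs_mul, neg_div, abs_neg, abs_of_pos (by positivity),
      one_div_mul_eq_div]
    exact div_le_div_of_nonneg_right (hC y) (by positivity)
  rw [viscousHJ_eq_smul_log, Pi.smul_apply, smul_eq_mul, abs_mul, neg_mul, abs_neg,
    abs_of_pos (show 0 < 2 * ε by positivity), mul_comm, ← le_div_iff₀ (by positivity)]
  exact h.abs_log_op_exp_le (A.smul_mem hf _) hbound (mul_nonneg hε.le ht) x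

end IsDiffusion

end MarkovSemigroup

lemma antitoneOn_log_div_of_deriv_le {F F' q q' : ℝ → ℝ} {a b : ℝ}
    (hF : ∀ s ∈ Icc a b, HasDerivWithinAt F (F' s) (Icc a b) s)
    (hq : ∀ s ∈ Icc a b, HasDerivWithinAt q (q' s) (Icc a b) s)
    (hFpos : ∀ s ∈ Icc a b, 0 < F s) (hqpos : ∀ s ∈ Icc a b, 0 < q s)
    (hle : ∀ s ∈ Icc a b, F' s ≤ q' s / q s * (F s * Real.log (F s))) :
    AntitoneOn (fun s => Real.log (F s) / q s) (Icc a b) := by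
  have hderiv := fun s (hs : s ∈ Icc a b) =>
    ((hF s hs).log (hFpos s hs).ne').fun_div (hq s hs) (hqpos s hs).ne'
  refine antitoneOn_of_hasDerivWithinAt_nonpos (convex_Icc a b)
    (fun s hs => (hderiv s hs).continuousWithinAt)
    (fun s hs => (hderiv s (interior_subset hs)).mono interior_subset) fun s hs => ?_
  have hFs := hFpos s (interior_subset hs)
  have hqs := hqpos s (interior_subset hs)
  have hle' : F' s * q s ≤ Real.log (F s) * q' s * F s := by
    refine (mul_le_mul_of_nonneg_right (hle s (interior_subset hs)) hqs.le).trans_eq ?_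
    field_simp
  refine div_nonpos_of_nonpos_of_nonneg (sub_nonpos.2 ?_) (sq_nonneg _)
  rwa [div_mul_eq_mul_div, div_le_iff₀ hFs]

namespace MarkovSemigroup

variable {E : Type*} [MeasurableSpace E] {P : MarkovSemigroup E} {A : Subalgebra ℝ (E → ℝ)}

lemma IsDiffusion.op_exp_mul_carreDuChamp_nonneg (h : P.IsDiffusion A) {w : E → ℝ} (hw : w ∈ A)
    (r : ℝ) (x : E) : 0 ≤ P.op r (fun y => Real.exp (w y) * P.carreDuChamp w w y) x :=
  integral_nonneg fun y => mul_nonneg (Real.exp_pos _).le (h.carreDuChamp_self_nonneg hw y)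

lemma IsDiffusion.op_exp_mul_sub (h : P.IsDiffusion A) {w : E → ℝ} (hw : w ∈ A) {r : ℝ}
    (hr : 0 ≤ r) (a b : ℝ) (x : E) :
    P.op r ((fun y => Real.exp (w y)) * (a • w - b • P.carreDuChamp w w)) x
      = a * P.op r (fun y => w y * Real.exp (w y)) x
        - b * P.op r (fun y => Real.exp (w y) * P.carreDuChamp w w y) x := by
  have hexp := h.exp_comp_mem hw
  rw [mul_sub, mul_smul_comm, mul_smul_comm, mul_comm _ w, h.op_sub
    (A.smul_mem (A.mul_mem hw hexp) a) (A.smul_mem (A.mul_mem hexp (h.carreDuChamp_mem hw hw)) b)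
    hr, op_smul, op_smul]
  rfl

namespace LocalLogSobolev

lemma mono {r c c' : ℝ} (hLSI : P.LocalLogSobolev A r c) (h : P.IsDiffusion A) (hc : c ≤ c') :
    P.LocalLogSobolev A r c' := fun f hf x =>
  (hLSI f hf x).trans
    (mul_le_mul_of_nonneg_right hc (h.op_exp_mul_carreDuChamp_nonneg hf r x))

lemma op_exp_mul_sub_le {r c : ℝ} (hLSI : P.LocalLogSobolev A r c)
    (h : P.IsDiffusion A) (hr : 0 ≤ r) {w : E → ℝ} (hw : w ∈ A) {a b : ℝ} (ha : 0 ≤ a)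
    (hab : a * c ≤ b) (x : E) :
    P.op r ((fun y => Real.exp (w y)) * (a • w - b • P.carreDuChamp w w)) x
      ≤ a * (P.op r (fun y => Real.exp (w y)) x
        * Real.log (P.op r (fun y => Real.exp (w y)) x)) := by
  rw [h.op_exp_mul_sub hw hr]
  have hent := mul_le_mul_of_nonneg_left (hLSI w hw x) ha
  have hcost := mul_le_mul_of_nonneg_right hab (h.op_exp_mul_carreDuChamp_nonneg hw r x)
  linarith

end LocalLogSobolev

namespace IsDiffusion

lemma hasUniformDeriv_mul_viscousHJ (h : P.IsDiffusion A) {f v : E → ℝ} (hf : f ∈ A)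
    {ε T s a b : ℝ} (hε : 0 < ε) (hs : s ∈ Icc 0 T) (hv : P.viscousHJ ε s f = v) :
    HasUniformDeriv (fun r => (a + r * b) • P.viscousHJ ε r f)
      (b • v + (a + s * b) • (ε • P.gen v - (1 / 2 : ℝ) • P.carreDuChamp v v)) T s := by
  have hq := HasUniformDeriv.of_quadratic (E := E) (isBigO_refl _ _ |>.const_mul_left a)
    (isBigO_refl _ _ |>.const_mul_left b) (isBigO_refl _ _ |>.const_mul_left 0) hs
  subst hv
  convert hq.mul (h.hasUniformDeriv_viscousHJ hf hε hs rfl) using 1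
  · ext r y
    simp
  · ext y
    simp

lemma antitoneOn_log_op_exp_mul_viscousHJ (h : P.IsDiffusion A) {q c u ε : ℝ} (hq : 0 < q)
    (hc : 0 < c) (hε : 0 < ε) (hLSI : ∀ r ∈ Icc 0 u, P.LocalLogSobolev A r c) {f : E → ℝ}
    (hf : f ∈ A) (x : E) :
    AntitoneOn (fun s => Real.log (P.op (ε * (u / ε - s))
      (fun y => Real.exp (((q + s * (1 / (2 * c))) • P.viscousHJ ε s f) y)) x)
        / (q + s * (1 / (2 * c)))) (Icc 0 (u / ε)) := by
  set T := u / ε with hT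
  set b := 1 / (2 * c) with hb
  have hb₀ : 0 < b := by positivity
  have hqpos : ∀ s ∈ Icc 0 T, 0 < q + s * b := fun s hs =>
    add_pos_of_pos_of_nonneg hq (mul_nonneg hs.1 hb₀.le)
  have hv : ∀ s ∈ Icc 0 T, P.viscousHJ ε s f ∈ A := fun s hs =>
    h.viscousHJ_mem hf (mul_nonneg hε.le hs.1)
  have hw := fun s hs => A.smul_mem (hv s hs) (q + s * b)
  have htime : ∀ s ∈ Icc 0 T, ε * (T - s) ∈ Icc 0 u := fun s hs =>
    ⟨mul_nonneg hε.le (sub_nonneg.2 hs.2), by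
      rw [mul_sub, hT, mul_div_cancel₀ u hε.ne']
      exact sub_le_self u (mul_nonneg hε.le hs.1)⟩
  refine antitoneOn_log_div_of_deriv_le (q' := fun _ => b)
    (fun s hs => h.hasDerivWithinAt_op_exp hε.le hw ?_
      (h.hasUniformDeriv_mul_viscousHJ hf hε hs rfl) x)
    (fun s _ => ?_) (fun s hs => h.op_exp_pos (hw s hs) (htime s hs).1 x) hqpos fun s hs => ?_
  · exact A.add_mem (A.smul_mem (hv s hs) _) (A.smul_mem (A.sub_mem
      (A.smul_mem (h.gen_mem _ (hv s hs)) _)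
      (A.smul_mem (h.carreDuChamp_mem (hv s hs) (hv s hs)) _)) _)
  · simpa using (((hasDerivAt_id s).mul_const b).const_add q).hasDerivWithinAt
  · have hqs := hqpos s hs
    -- `2 b c = 1`: the growth of the exponent pays exactly for the entropy production.
    have hcoef : b / (q + s * b) * c ≤ ε + 1 / (2 * (q + s * b)) := by
      have : b * c = 1 / 2 := by rw [hb]; field_simp
      rw [div_mul_eq_mul_div, this, div_div, le_add_iff_nonneg_left]
      exact hε.le
    convert (hLSI _ (htime s hs)).op_exp_mul_sub_le h (htime s hs).1 (hw s hs)
      (div_nonneg hb₀.le hqs.le) hcoef x using 3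
    rw [h.gen_smul (hv s hs), h.carreDuChamp_smul_self (hv s hs)]
    generalize q + s * b = p at hqs
    ext y
    simp only [Pi.sub_apply, Pi.add_apply, Pi.smul_apply, smul_eq_mul]
    field_simp
    ring

lemma exp_mul_log_op_exp_mem (h : P.IsDiffusion A) {f : E → ℝ} (hf : f ∈ A) {u : ℝ} (hu : 0 ≤ u)
    (a : ℝ) : (fun x => Real.exp (a * Real.log (P.op u (fun y => Real.exp (f y)) x))) ∈ A :=
  h.exp_comp_mem (A.smul_mem (h.log_op_exp_mem hf hu) a)

lemma op_sub_exp_viscousHJ_le (h : P.IsDiffusion A) {q c u ε t : ℝ} (hq : 0 < q) (hc : 0 < c)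
    (hε : 0 < ε) (ht : 0 ≤ t) (hεt : ε * t ≤ u) (hLSI : ∀ r ∈ Icc 0 u, P.LocalLogSobolev A r c)
    {f : E → ℝ} (hf : f ∈ A) (x : E) :
    P.op (u - ε * t) (fun y => Real.exp (((q + t / (2 * c)) • P.viscousHJ ε t f) y)) x
      ≤ Real.exp ((q + t / (2 * c)) / q * Real.log (P.op u (fun y => Real.exp ((q • f) y)) x)) := by
  have hq₁ : 0 < q + t / (2 * c) := by positivity
  have hεtu : ε * (u / ε - t) = u - ε * t := by field_simp
  have hT : t ≤ u / ε := (le_div_iff₀' hε).2 hεt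
  have hle := h.antitoneOn_log_op_exp_mul_viscousHJ hq hc hε hLSI hf x
    ⟨le_rfl, ht.trans hT⟩ ⟨ht, hT⟩ ht
  simp only [hεtu, h.viscousHJ_zero hf hε.ne', sub_zero, mul_div_cancel₀ u hε.ne', mul_one_div,
    zero_div, add_zero] at hle
  rw [div_le_iff₀' hq₁, mul_div_left_comm, mul_comm (Real.log _)] at hle
  exact (Real.log_le_iff_le_exp (h.op_exp_pos
    (A.smul_mem (h.viscousHJ_mem hf (mul_nonneg hε.le ht)) _) (sub_nonneg.2 hεt) x)).1 hle

theorem op_exp_viscousHJ_le (h : P.IsDiffusion A) {q c u ε t : ℝ} (hq : 0 < q) (hc : 0 < c)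
    (hε : 0 < ε) (ht : 0 ≤ t) (hεt : ε * t ≤ u) (hLSI : ∀ r ∈ Icc 0 u, P.LocalLogSobolev A r c)
    {f : E → ℝ} (hf : f ∈ A) (x : E) :
    P.op u (fun y => Real.exp (((q + t / (2 * c)) • P.viscousHJ ε t f) y)) x
      ≤ P.op (ε * t) (fun y => Real.exp
        ((q + t / (2 * c)) / q * Real.log (P.op u (fun z => Real.exp ((q • f) z)) y))) x := by
  have hεt₀ : 0 ≤ ε * t := mul_nonneg hε.le ht
  have hu : 0 ≤ u := hεt₀.trans hεt
  have hexp := h.exp_comp_mem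
    (A.smul_mem (h.viscousHJ_mem hf hεt₀) (q + t / (2 * c)))
  have hsemigroup := h.op_add hexp hεt₀ (sub_nonneg.2 hεt) x
  rw [add_sub_cancel] at hsemigroup
  rw [hsemigroup]
  exact op_mono h (h.op_mem _ (sub_nonneg.2 hεt) _ hexp)
    (h.exp_mul_log_op_exp_mem (A.smul_mem hf q) hu _) hεt₀
    (h.op_sub_exp_viscousHJ_le hq hc hε ht hεt hLSI hf) x

end IsDiffusion

end MarkovSemigroup

namespace MarkovSemigroup

variable {E : Type*} [MeasurableSpace E] {P : MarkovSemigroup E} {A : Subalgebra ℝ (E → ℝ)}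

lemma measurable_viscousHJ {f : E → ℝ} (hf : Measurable f) (ε t : ℝ) :
    Measurable (P.viscousHJ ε t f) := by
  have hexp : StronglyMeasurable fun y => Real.exp (-f y / (2 * ε)) := by
    refine Measurable.stronglyMeasurable ?_
    fun_prop
  exact (hexp.integral_kernel (κ := P.kernel (ε * t))).measurable.log.const_mul _

namespace IsDiffusion

lemma isBoundedUnder_ge_viscousHJ (h : P.IsDiffusion A) {f : E → ℝ} (hf : f ∈ A) {t : ℝ}
    (ht : 0 ≤ t) (x : E) :
    IsBoundedUnder (· ≥ ·) (𝓝[>] (0 : ℝ)) fun ε => P.viscousHJ ε t f x := by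
  obtain ⟨C, hC⟩ := h.bounded f hf
  refine isBoundedUnder_of_eventually_ge (a := -C) ?_
  filter_upwards [self_mem_nhdsWithin] with ε hε
  exact (abs_le.1 (h.abs_viscousHJ_le hf hC hε ht x)).1

lemma isCoboundedUnder_ge_viscousHJ (h : P.IsDiffusion A) {f : E → ℝ} (hf : f ∈ A) {t : ℝ}
    (ht : 0 ≤ t) (x : E) :
    IsCoboundedUnder (· ≥ ·) (𝓝[>] (0 : ℝ)) fun ε => P.viscousHJ ε t f x := by
  obtain ⟨C, hC⟩ := h.bounded f hf
  refine (isBoundedUnder_of_eventually_le (a := C) ?_).isCoboundedUnder_ge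
  filter_upwards [self_mem_nhdsWithin] with ε hε
  exact (abs_le.1 (h.abs_viscousHJ_le hf hC hε ht x)).2

lemma le_hamiltonJacobi (h : P.IsDiffusion A) {f : E → ℝ} (hf : f ∈ A) {t : ℝ} (ht : 0 ≤ t)
    {x : E} {a : ℝ} (ha : ∀ᶠ ε in 𝓝[>] (0 : ℝ), a ≤ P.viscousHJ ε t f x) :
    a ≤ P.hamiltonJacobi t f x :=
  le_liminf_of_le (h.isCoboundedUnder_ge_viscousHJ hf ht x) ha

lemma abs_hamiltonJacobi_le (h : P.IsDiffusion A) {f : E → ℝ} (hf : f ∈ A) {C : ℝ}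
    (hC : ∀ x, |f x| ≤ C) {t : ℝ} (ht : 0 ≤ t) (x : E) : |P.hamiltonJacobi t f x| ≤ C := by
  have hbound : ∀ᶠ ε in 𝓝[>] (0 : ℝ), |P.viscousHJ ε t f x| ≤ C := by
    filter_upwards [self_mem_nhdsWithin] with ε hε using h.abs_viscousHJ_le hf hC hε ht x
  refine abs_le.2 ⟨h.le_hamiltonJacobi hf ht (hbound.mono fun ε hε => (abs_le.1 hε).1), ?_⟩
  refine liminf_le_of_le (h.isBoundedUnder_ge_viscousHJ hf ht x) fun b hb => ?_
  obtain ⟨ε, hbε, hε⟩ := (hb.and hbound).exists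
  exact hbε.trans (abs_le.1 hε).2

lemma integrable_exp_hamiltonJacobi (h : P.IsDiffusion A) {f : E → ℝ} (hf : f ∈ A) {t u : ℝ}
    (ht : 0 ≤ t) (hu : 0 ≤ u) (q : ℝ) (x : E) :
    Integrable (fun y => Real.exp (q * P.hamiltonJacobi t f y)) (P.kernel u x) := by
  obtain ⟨C, hC⟩ := h.bounded f hf
  have := P.isMarkov u hu
  have hQ := h.measurable_hamiltonJacobi hf ht
  refine Integrable.of_bound (by fun_prop) (Real.exp (|q| * C)) (ae_of_all _ fun y => ?_)
  rw [Real.norm_eq_abs, Real.abs_exp, Real.exp_le_exp]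
  refine (le_abs_self _).trans ?_
  rw [abs_mul]
  exact mul_le_mul_of_nonneg_left (h.abs_hamiltonJacobi_le hf hC ht y) (abs_nonneg q)

lemma op_exp_hamiltonJacobi_le (h : P.IsDiffusion A) {f : E → ℝ} (hf : f ∈ A) {t u q B : ℝ}
    {b : ℝ → ℝ} (ht : 0 ≤ t) (hu : 0 ≤ u) (hq : 0 ≤ q) (hb : Tendsto b (𝓝[>] 0) (𝓝 B)) {x : E}
    (hle : ∀ᶠ ε in 𝓝[>] (0 : ℝ), P.op u (fun y => Real.exp ((q • P.viscousHJ ε t f) y)) x ≤ b ε) :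
    P.op u (fun y => Real.exp (q * P.hamiltonJacobi t f y)) x ≤ B := by
  have hB : 0 ≤ B := ge_of_tendsto hb
    (hle.mono fun ε hε => (integral_nonneg fun y => (Real.exp_pos _).le).trans hε)
  have hliminf : ∀ y, ENNReal.ofReal (Real.exp (q * P.hamiltonJacobi t f y))
      = liminf (fun ε => ENNReal.ofReal (Real.exp (q * P.viscousHJ ε t f y))) (𝓝[>] 0) := fun y =>
    Monotone.map_liminf_of_continuousAt (f := fun r => ENNReal.ofReal (Real.exp (q * r)))
      (fun r s hrs => ENNReal.ofReal_le_ofReal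
        (Real.exp_le_exp.2 (mul_le_mul_of_nonneg_left hrs hq))) _
      (ENNReal.continuous_ofReal.comp (by fun_prop)).continuousAt
      (h.isCoboundedUnder_ge_viscousHJ hf ht y) (h.isBoundedUnder_ge_viscousHJ hf ht y)
  have hv := fun ε => P.measurable_viscousHJ (h.measurable f hf) ε t
  rw [← ENNReal.ofReal_le_ofReal_iff hB, op, ofReal_integral_eq_lintegral_ofReal
    (h.integrable_exp_hamiltonJacobi hf ht hu q x) (ae_of_all _ fun y => (Real.exp_pos _).le)]
  simp only [hliminf]
  calc ∫⁻ y, liminf (fun ε => ENNReal.ofReal (Real.exp (q * P.viscousHJ ε t f y))) (𝓝[>] 0)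
        ∂(P.kernel u x)
      ≤ liminf (fun ε => ∫⁻ y, ENNReal.ofReal (Real.exp (q * P.viscousHJ ε t f y))
          ∂(P.kernel u x)) (𝓝[>] 0) :=
        lintegral_liminf_le fun ε => by have := hv ε; fun_prop
    _ ≤ liminf (fun ε => ENNReal.ofReal (b ε)) (𝓝[>] 0) := by
        refine liminf_le_liminf ?_
        filter_upwards [hle, self_mem_nhdsWithin] with ε hε hε₀
        have hexp := h.exp_comp_mem (A.smul_mem (h.viscousHJ_mem hf (mul_nonneg hε₀.le ht)) q)
        exact (ofReal_integral_eq_lintegral_ofReal (h.integrable hexp hu x)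
          (ae_of_all _ fun y => (Real.exp_pos _).le)).symm.trans_le (ENNReal.ofReal_le_ofReal hε)
    _ = ENNReal.ofReal B := (ENNReal.tendsto_ofReal hb).liminf_eq

theorem hypercontractivity (h : P.IsDiffusion A) {q c u t : ℝ} (hq : 0 < q) (hc : 0 < c)
    (hu : 0 < u) (ht : 0 ≤ t) (hLSI : ∀ r ∈ Icc 0 u, P.LocalLogSobolev A r c) {f : E → ℝ}
    (hf : f ∈ A) (x : E) :
    (P.op u (fun y => Real.exp ((q + t / (2 * c)) * P.hamiltonJacobi t f y)) x)
        ^ (1 / (q + t / (2 * c)))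
      ≤ (P.op u (fun y => Real.exp (q * f y)) x) ^ (1 / q) := by
  have hqf := A.smul_mem hf q
  have hpos := h.op_exp_pos hqf hu.le x
  have hMA := h.exp_mul_log_op_exp_mem hqf hu.le ((q + t / (2 * c)) / q)
  have htime : Tendsto (fun ε => ε * t) (𝓝[>] 0) (𝓝[≥] 0) := by
    refine tendsto_nhdsWithin_iff.2 ⟨?_, ?_⟩
    · simpa using ((continuous_mul_const t).tendsto 0).mono_left nhdsWithin_le_nhds
    · filter_upwards [self_mem_nhdsWithin] with ε hε using mul_nonneg hε.le ht
  have hlim := (h.continuousOn hMA x 0 self_mem_Ici).tendsto.comp htime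
  rw [op_zero (h.measurable _ hMA)] at hlim
  have hle := h.op_exp_hamiltonJacobi_le hf ht hu.le
    (show 0 ≤ q + t / (2 * c) by positivity) (x := x) hlim <| by
    filter_upwards [(htime.mono_right nhdsWithin_le_nhds).eventually_le_const hu,
      self_mem_nhdsWithin] with ε hεt hε using h.op_exp_viscousHJ_le hq hc hε ht hεt hLSI hf x
  calc _ ≤ _ := Real.rpow_le_rpow (integral_nonneg fun y => (Real.exp_pos _).le) hle
        (by positivity)
    _ = (P.op u (fun y => Real.exp ((q • f) y)) x) ^ (1 / q) := by
        rw [← Real.exp_mul, Real.rpow_def_of_pos hpos]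
        field_simp

end IsDiffusion

end MarkovSemigroup

namespace MarkovSemigroup

variable {E : Type*} [MeasurableSpace E] {P : MarkovSemigroup E} {A : Subalgebra ℝ (E → ℝ)}

namespace IsDiffusion

lemma exists_le_gen_sub_carreDuChamp (h : P.IsDiffusion A) {f : E → ℝ} (hf : f ∈ A) :
    ∃ K C, ∀ ε, 0 ≤ ε → ∀ s ∈ Icc (0 : ℝ) 1, ∀ y,
      -(1 / 2) * P.carreDuChamp f f y - ε * C - 2 * K * s
        ≤ ε * P.gen (f + (-s / 2) • P.carreDuChamp f f) y
          - 1 / 2 * P.carreDuChamp (f + (-s / 2) • P.carreDuChamp f f)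
            (f + (-s / 2) • P.carreDuChamp f f) y := by
  have hG := h.carreDuChamp_mem hf hf
  set G := P.carreDuChamp f f with hGdef
  obtain ⟨M₁, hM₁⟩ := h.bounded _ (h.carreDuChamp_mem hf hG)
  obtain ⟨M₂, hM₂⟩ := h.bounded _ (h.carreDuChamp_mem hG hG)
  obtain ⟨M₃, hM₃⟩ := h.bounded _ (h.gen_mem _ hf)
  obtain ⟨M₄, hM₄⟩ := h.bounded _ (h.gen_mem _ hG)
  refine ⟨M₁ + M₂, M₃ + M₄, fun ε hε s hs y => ?_⟩
  rw [h.gen_add hf (A.smul_mem hG _), h.gen_smul hG, h.carreDuChamp_add_smul_self hf hG, ← hGdef]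
  simp only [Pi.add_apply, Pi.smul_apply, smul_eq_mul]
  have hgen : -(M₃ + M₄) ≤ P.gen f y + -s / 2 * P.gen G y := by
    nlinarith [abs_le.1 (hM₃ y), abs_le.1 (hM₄ y), hs.1, hs.2]
  have hmixed : -(s * M₁) ≤ s * P.carreDuChamp f G y := by
    nlinarith [abs_le.1 (hM₁ y), hs.1]
  have hsquare : s ^ 2 * P.carreDuChamp G G y ≤ s * M₂ := by
    exact mul_le_mul (by nlinarith [hs.1, hs.2]) ((le_abs_self _).trans (hM₂ y))
      (h.carreDuChamp_self_nonneg hG y) hs.1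
  have hM₁s := mul_nonneg hs.1 ((abs_nonneg _).trans (hM₁ y))
  have hM₂s := mul_nonneg hs.1 ((abs_nonneg _).trans (hM₂ y))
  linarith [mul_le_mul_of_nonneg_left hgen hε]

lemma exists_le_viscousHJ (h : P.IsDiffusion A) {f : E → ℝ} (hf : f ∈ A) :
    ∃ K C, ∀ ε, 0 < ε → ∀ t ∈ Icc (0 : ℝ) 1, ∀ x,
      f x - t / 2 * P.carreDuChamp f f x - K * t ^ 2 - ε * C * t ≤ P.viscousHJ ε t f x := by
  obtain ⟨K, C, hKC⟩ := h.exists_le_gen_sub_carreDuChamp hf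
  have hG := h.carreDuChamp_mem hf hf
  set G := P.carreDuChamp f f
  refine ⟨K, C, fun ε hε t ht x => ?_⟩
  have hv := fun s : ℝ => A.add_mem hf (A.smul_mem hG (-s / 2))
  set w : ℝ → E → ℝ := fun s => (f + (-s / 2) • G) + fun _ => -(ε * C) * s - K * s ^ 2 with hw
  have hd : ∀ s : ℝ, (-(1 / 2 : ℝ) • G + fun _ => -(ε * C) - 2 * K * s) ∈ A := fun s =>
    A.add_mem (A.smul_mem hG _) (const_mem A _)
  have hwd : ∀ s ∈ Icc 0 t,
      HasUniformDeriv w (-(1 / 2 : ℝ) • G + fun _ => -(ε * C) - 2 * K * s) t s := fun s hs => by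
    convert HasUniformDeriv.of_quadratic (h.isBigO_one hf ⊤ id)
      (h.isBigO_one (A.add_mem (A.smul_mem hG (-(1 / 2 : ℝ))) (const_mem A (-(ε * C)))) ⊤ id)
      (h.isBigO_one (const_mem A (-K)) ⊤ id) hs using 1
    · ext r y
      simp only [hw, id, Pi.add_apply, Pi.smul_apply, smul_eq_mul]
      ring
    · ext y
      simp only [id, Pi.add_apply, Pi.smul_apply, smul_eq_mul]
      ring
  have hw₀ : w 0 = f := by
    ext y
    simp [hw]
  have hle := h.le_viscousHJ_of_subsolution hε ht.1 (w := w)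
    (fun s _ => A.add_mem (hv s) (const_mem A _)) (fun s _ => hd s) hwd (fun s hs y => ?_) x
  · rw [hw₀] at hle
    refine (le_of_eq ?_).trans hle
    simp only [hw, Pi.add_apply, Pi.smul_apply, smul_eq_mul]
    ring
  · simp only [hw]
    rw [h.carreDuChamp_add_const_self (hv s), h.gen_add (hv s) (const_mem A _), gen_const, add_zero]
    refine (le_of_eq ?_).trans (hKC ε hε.le s ⟨hs.1, hs.2.trans ht.2⟩ y)
    simp only [Pi.add_apply, Pi.smul_apply, smul_eq_mul]
    ring

lemma exists_le_hamiltonJacobi (h : P.IsDiffusion A) {f : E → ℝ} (hf : f ∈ A) :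
    ∃ K, ∀ t ∈ Icc (0 : ℝ) 1, ∀ x,
      f x - t / 2 * P.carreDuChamp f f x - K * t ^ 2 ≤ P.hamiltonJacobi t f x := by
  obtain ⟨K, C, hKC⟩ := h.exists_le_viscousHJ hf
  refine ⟨K, fun t ht x => le_of_forall_pos_sub_le fun η hη =>
    h.le_hamiltonJacobi hf ht.1 ?_⟩
  have hlim : Tendsto (fun ε : ℝ => ε * C * t) (𝓝[>] 0) (𝓝 0) := by
    have : Continuous fun ε : ℝ => ε * C * t := by fun_prop
    simpa using (this.tendsto 0).mono_left nhdsWithin_le_nhds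
  filter_upwards [hlim.eventually_le_const hη, self_mem_nhdsWithin] with ε hεη hε
  linarith [hKC ε hε t ht x]

lemma hasDerivWithinAt_op_exp_mul_sub (h : P.IsDiffusion A) {u : ℝ} (hu : 0 ≤ u) {f : E → ℝ}
    (hf : f ∈ A) (b K : ℝ) (x : E) :
    HasDerivWithinAt (fun t => P.op u (fun y => Real.exp
        ((1 + t * b) * (f y - t / 2 * P.carreDuChamp f f y - K * t ^ 2))) x)
      (P.op u ((fun y => Real.exp (f y)) * (b • f - (1 / 2 : ℝ) • P.carreDuChamp f f)) x)
      (Icc 0 1) 0 := by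
  have hG := h.carreDuChamp_mem hf hf
  have h0 : (0 : ℝ) ∈ Icc (0 : ℝ) 1 := ⟨le_rfl, zero_le_one⟩
  have hexponent := HasUniformDeriv.of_quadratic (E := E) (isBigO_refl _ _ |>.const_mul_left 1)
    (isBigO_refl _ _ |>.const_mul_left b) (isBigO_refl _ _ |>.const_mul_left 0) h0
  have hprofile := HasUniformDeriv.of_quadratic (h.isBigO_one hf ⊤ id)
    (h.isBigO_one (A.smul_mem hG (-(1 / 2 : ℝ))) ⊤ id)
    (h.isBigO_one (const_mem A (-K)) ⊤ id) h0
  refine h.hasDerivWithinAt_op_const hu (fun t _ => ?_) ?_ ?_ x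
  · exact h.exp_comp_mem (A.smul_mem (A.sub_mem (A.sub_mem hf (A.smul_mem hG (t / 2)))
      (const_mem A (K * t ^ 2))) (1 + t * b))
  · exact A.mul_mem (h.exp_comp_mem hf) (A.sub_mem (A.smul_mem hf b) (A.smul_mem hG _))
  · convert (hexponent.mul hprofile).exp using 1
    · ext t y
      simp only [id, Pi.smul_apply, smul_eq_mul]
      ring_nf
    · ext y
      simp only [id, Pi.smul_apply, Pi.mul_apply, Pi.sub_apply, smul_eq_mul]
      ring_nf

lemma op_exp_mul_le_rpow (h : P.IsDiffusion A) {f w : E → ℝ} (hf : f ∈ A) (hw : w ∈ A)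
    {t u q J : ℝ} (ht : 0 ≤ t) (hu : 0 ≤ u) (hq : 0 < q) (hJ : 0 ≤ J)
    (hwf : ∀ y, w y ≤ P.hamiltonJacobi t f y) {x : E}
    (hle : (P.op u (fun y => Real.exp (q * P.hamiltonJacobi t f y)) x) ^ (1 / q) ≤ J) :
    P.op u (fun y => Real.exp (q * w y)) x ≤ J ^ q := by
  refine (integral_mono (h.integrable (h.exp_comp_mem (A.smul_mem hw q)) hu x)
    (h.integrable_exp_hamiltonJacobi hf ht hu q x)
    fun y => Real.exp_le_exp.2 (mul_le_mul_of_nonneg_left (hwf y) hq.le)).trans ?_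
  rw [one_div] at hle
  exact (Real.rpow_inv_le_iff_of_pos (integral_nonneg fun y => (Real.exp_pos _).le) hJ hq).1 hle

theorem localLogSobolev_of_hypercontractivity (h : P.IsDiffusion A) {u c : ℝ} (hu : 0 ≤ u)
    (hc : 0 < c)
    (hH : ∀ t, 0 < t → ∀ f ∈ A, ∀ x,
      (P.op u (fun y => Real.exp ((1 + t / (2 * c)) * P.hamiltonJacobi t f y)) x)
        ^ (1 / (1 + t / (2 * c))) ≤ P.op u (fun y => Real.exp (f y)) x) :
    P.LocalLogSobolev A u c := by
  intro f hf x
  obtain ⟨K, hK⟩ := h.exists_le_hamiltonJacobi hf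
  set J := P.op u (fun y => Real.exp (f y)) x
  have hJ : 0 < J := h.op_exp_pos hf hu x
  have hpow : HasDerivWithinAt (fun t => J ^ (1 + t * (1 / (2 * c))))
      (1 / (2 * c) * (J * Real.log J)) (Icc 0 1) 0 := by
    have hlin : HasDerivAt (fun t => 1 + t * (1 / (2 * c))) (1 / (2 * c)) 0 := by
      simpa using ((hasDerivAt_id (0 : ℝ)).mul_const (1 / (2 * c))).const_add 1
    refine (hlin.const_rpow hJ).hasDerivWithinAt.congr_deriv ?_
    rw [zero_mul, add_zero, Real.rpow_one]
    ring
  have hmax : IsLocalMaxOn (fun t => P.op u (fun y => Real.exp ((1 + t * (1 / (2 * c)))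
      * (f y - t / 2 * P.carreDuChamp f f y - K * t ^ 2))) x - J ^ (1 + t * (1 / (2 * c))))
      (Icc 0 1) 0 := by
    filter_upwards [self_mem_nhdsWithin] with t ht
    rcases ht.1.eq_or_lt with rfl | ht₀
    · rfl
    have hq : 0 < 1 + t * (1 / (2 * c)) := by positivity
    have hw := A.sub_mem (A.sub_mem hf (A.smul_mem (h.carreDuChamp_mem hf hf) (t / 2)))
      (const_mem A (K * t ^ 2))
    have hle := h.op_exp_mul_le_rpow hf hw ht.1 hu hq hJ.le (hK t ht)
      (by simpa only [mul_one_div] using hH t ht₀ f hf x)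
    have hle₀ : J ^ (1 + 0 * (1 / (2 * c))) = P.op u (fun y => Real.exp
        ((1 + 0 * (1 / (2 * c))) * (f y - 0 / 2 * P.carreDuChamp f f y - K * 0 ^ 2))) x := by
      simp [J]
    exact (sub_nonpos.2 hle).trans_eq (sub_eq_zero.2 hle₀.symm).symm
  have hderiv := deriv_nonpos_of_isLocalMaxOn (mem_closure_Ioi_inter_Icc one_pos)
    ((h.hasDerivWithinAt_op_exp_mul_sub hu hf _ K x).fun_sub hpow) hmax
  rw [h.op_exp_mul_sub hf hu] at hderiv
  have := mul_nonpos_of_nonneg_of_nonpos (mul_pos two_pos hc).le hderiv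
  field_simp at this
  linarith

end IsDiffusion

end MarkovSemigroup

lemma exponent_gain_eq_div_sobolevConst (ρ t u : ℝ) :
    (if ρ = 0 then t / (2 * u) else ρ * t / (1 - Real.exp (-2 * ρ * u)))
      = t / (2 * sobolevConst ρ u) := by
  split_ifs with hρ
  · rw [hρ, sobolevConst_zero_left]
  · rw [sobolevConst_of_ne_zero hρ]
    field_simp

theorem mainTheorem4 {E : Type*} [MeasurableSpace E] (P : MarkovSemigroup E)
    (A : Subalgebra ℝ (E → ℝ)) (hP : P.IsDiffusion A) (ρ : ℝ) :
    P.CDInfty A ρ ↔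
      ∀ q₁ q₂ u t : ℝ, 0 < q₂ → q₂ < q₁ → 0 < u → 0 < t →
        q₁ = q₂ + (if ρ = 0 then t / (2 * u) else ρ * t / (1 - Real.exp (-2 * ρ * u))) →
        ∀ f ∈ A, ∀ x : E,
          (P.op u (fun y => Real.exp (q₁ * P.hamiltonJacobi t f y)) x) ^ (1 / q₁) ≤
            (P.op u (fun y => Real.exp (q₂ * f y)) x) ^ (1 / q₂) := by
  simp only [exponent_gain_eq_div_sobolevConst]
  constructor
  · rintro hCD _ q u t hq - hu ht rfl f hf x
    have hLSI : ∀ r ∈ Icc 0 u, P.LocalLogSobolev A r (sobolevConst ρ u) := fun r hr =>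
      (hP.localLogSobolev_of_CDInfty hCD hr.1).mono hP ((strictMono_sobolevConst ρ).monotone hr.2)
    exact hP.hypercontractivity hq (sobolevConst_pos ρ hu) hu ht.le hLSI hf x
  · intro hHC
    refine hP.CDInfty_of_localLogSobolev fun u hu => ?_
    have hc := sobolevConst_pos ρ hu
    refine hP.localLogSobolev_of_hypercontractivity hu.le hc fun t ht f hf x => ?_
    simpa using hHC (1 + t / (2 * sobolevConst ρ u)) 1 u t one_pos
      (lt_add_of_pos_right 1 (by positivity)) hu ht rfl f hf x
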